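/- **Setting.** Let $(\mathcal G,\underline a)$ be a finite metric graph: finitely many vertices, a finite set $\mathcal I$ of internal edges $i$, identified with the intervals $I_i=[0,a_i]$, $a_i>0$, and a finite set $\mathcal E$ of external edges $e$, identified with $I_e=[0,\infty)$. The edges are divided into positive and negative ones, $\mathcal E=\mathcal E_+\,\dot\cup\,\mathcal E_-$, $\mathcal I=\mathcal I_+\,\dot\cup\,\mathcal I_-$. The graph is called compact if $\mathcal E=\emptyset$. In $\mathcal H=\bigoplus_{j\in\mathcal E\cup\mathcal I}L^2(I_j)$ let $\mathcal D$ be the set of all $\psi=(\psi_j)_j\in\mathcal H$ such that each $\psi_j$ and its derivative $\psi_j'$ are (locally) absolutely continuous on $I_j$ and $\psi_j''\in L^2(I_j)$, and let $(\tau\psi)_j=-\psi_j''$ for $j\in\mathcal E_+\cup\mathcal I_+$ and $(\tau\psi)_j=+\psi_j''$ for $j\in\mathcal E_-\cup\mathcal I_-$. For $\psi\in\mathcal D$ let $$\underline\psi=\big(\{\psi_e(0)\}_{e\in\mathcal E},\{\psi_i(0)\}_{i\in\mathcal I},\{\psi_i(a_i)\}_{i\in\mathcal I}\big),\qquad \underline{\psi'}=\big(\{\psi_e'(0)\}_{e\in\mathcal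 E},\{\psi_i'(0)\}_{i\in\mathcal I},\{-\psi_i'(a_i)\}_{i\in\mathcal I}\big)$$ be the vectors of boundary values in $\mathcal K=\mathbb C^{|\mathcal E|+2|\mathcal I|}$. For linear maps $A,B$ in $\mathcal K$ let $T(A,B)$ be the operator $\psi\mapsto\tau\psi$ in $\mathcal H$ with domain $\{\psi\in\mathcal D: A\underline\psi+B\underline{\psi'}=0\}$. For $\lambda>0$ let $N_+(\lambda)$ be the number of eigenvalues of $T(A,B)$ in $(0,\lambda)$ and $N_-(\lambda)$ the number of eigenvalues of $T(A,B)$ in $(-\lambda,0)$, counted with multiplicities. **Proposition 6.6.** Let $T(A,B)$ be self-adjoint. 1. If the graph is compact, then for both signs $N_\pm(\lambda)$ is finite for all $\lambda$, and $$N_\pm(\lambda)\sim\frac1\pi\Big(\sum_{i\in\mathcal I_\pm}a_i\Big)\lambda^{1/2}\qquad(\lambda\to\infty),$$ that is, $\lambda^{-1/2}N_\pm(\lambda)\to\frac1\pi\sum_{i\in\mathcal I_\pm}a_i$ (in particular $N_\pm(\lambda)=o(\lambda^{1/2})$ if $\mathcal I_\pm=\emptyset$). 2. If the graph is non-compact and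 $\mathcal E_-=\emptyset$, then $N_-(\lambda)$ is finite for all $\lambda$ and the formula for $N_-(\lambda)$ in (1) still holds. If the graph is non-compact and $\mathcal E_+=\emptyset$, then $N_+(\lambda)$ is finite for all $\lambda$ and the formula for $N_+(\lambda)$ in (1) still holds. -/

import Mathlib

open MeasureTheory Filter Topology Set

noncomputable section

/-- A metric graph with vertex set `V`, internal edges `I` and external edges `E`, together with a
partition of the edges into positive edges (`sgn = 1`) and negative edges (`sgn = -1`).
An edge is an element of `E ⊕ I`. The graph is finite if `V`, `I`, `E` are finite types, and a
finite graph is compact if `E` is empty. -/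
structure SignedMetricGraph (V E I : Type*) where
  /-- initial and terminal vertex of an internal edge -/
  bdInt : I → V × V
  /-- initial vertex of an external edge -/
  bdExt : E → V
  /-- length of an internal edge -/
  a : I → ℝ
  a_pos : ∀ i, 0 < a i
  /-- sign of an edge -/
  sgn : E ⊕ I → ℤˣ

namespace SignedMetricGraph

variable {V E I : Type*}

/-- The internal edges of sign `s`. -/
def intEdges [Fintype I] (G : SignedMetricGraph V E I) (s : ℤˣ) : Finset I :=
  Finset.univ.filter fun i => G.sgn (Sum.inr i) = s

/-- The external edges of sign `s`. -/
def extEdges [Fintype E] (G : SignedMetricGraph V E I) (s : ℤˣ) : Finset E :=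
  Finset.univ.filter fun e => G.sgn (Sum.inl e) = s

/-- The interval attached to an edge: `[0, ∞)` for external edges, `[0, a i]` for internal ones. -/
def interval (G : SignedMetricGraph V E I) : E ⊕ I → Set ℝ
  | Sum.inl _ => Ici 0
  | Sum.inr i => Icc 0 (G.a i)

/-- The Hilbert space `⨁ⱼ L²(Iⱼ)` of the graph. -/
abbrev Hilb [Fintype E] [Fintype I] (G : SignedMetricGraph V E I) : Type _ :=
  PiLp 2 fun j : E ⊕ I => Lp ℂ 2 (volume.restrict (G.interval j))

end SignedMetricGraph

/-- The space of boundary values: one coordinate for each external edge (at `0`), and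
two for each internal edge (at `0` and at the terminal end point). -/
abbrev BoundarySpace (E I : Type*) : Type _ := EuclideanSpace ℂ (E ⊕ (I ⊕ I))

/-- Absolute continuity on every compact interval with end points in `s`. For `s = [0, a]` this is
absolute continuity on `[0, a]`, for `s = [0, ∞)` it is local absolute continuity. -/
def LocallyAC (s : Set ℝ) (f : ℝ → ℂ) : Prop :=
  ∀ x ∈ s, ∀ y ∈ s, AbsolutelyContinuousOnInterval f x y

/-- The class `ψ ∈ L²(s)` has the representative `u`, which is absolutely continuous with
derivative `v`; the derivative `v` is absolutely continuous, and has the square integrable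
derivative `w`. -/
structure IsH2Rep (s : Set ℝ) (ψ : Lp ℂ 2 (volume.restrict s)) (u v : ℝ → ℂ)
    (w : Lp ℂ 2 (volume.restrict s)) : Prop where
  ae_eq : ψ =ᵐ[volume.restrict s] u
  ac : LocallyAC s u
  deriv : ∀ x ∈ s, HasDerivWithinAt u (v x) s x
  ac_deriv : LocallyAC s v
  deriv_deriv : ∀ᵐ x ∂(volume.restrict s), HasDerivWithinAt v (w x) s x

theorem LocallyAC.add {s : Set ℝ} {f g : ℝ → ℂ} (hf : LocallyAC s f) (hg : LocallyAC s g) :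
    LocallyAC s (f + g) := fun x hx y hy => (hf x hx y hy).add (hg x hx y hy)

theorem LocallyAC.const_smul {s : Set ℝ} {f : ℝ → ℂ} (c : ℂ) (hf : LocallyAC s f) :
    LocallyAC s (c • f) := fun x hx y hy => (hf x hx y hy).const_smul c

theorem IsH2Rep.zero (s : Set ℝ) : IsH2Rep s 0 0 0 0 where
  ae_eq := Lp.coeFn_zero _ _ _
  ac x _ y _ := by simpa [AbsolutelyContinuousOnInterval] using tendsto_const_nhds
  deriv x _ := hasDerivWithinAt_const x s (0 : ℂ)
  ac_deriv x _ y _ := by simpa [AbsolutelyContinuousOnInterval] using tendsto_const_nhds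
  deriv_deriv := by
    filter_upwards [Lp.coeFn_zero ℂ 2 (volume.restrict s)] with x hx
    rw [hx]
    exact hasDerivWithinAt_const x s (0 : ℂ)

theorem IsH2Rep.add {s : Set ℝ} {ψ ψ' w w' : Lp ℂ 2 (volume.restrict s)} {u v u' v' : ℝ → ℂ}
    (h : IsH2Rep s ψ u v w) (h' : IsH2Rep s ψ' u' v' w') :
    IsH2Rep s (ψ + ψ') (u + u') (v + v') (w + w') where
  ae_eq := (Lp.coeFn_add _ _).trans (h.ae_eq.add h'.ae_eq)
  ac := h.ac.add h'.ac
  deriv x hx := (h.deriv x hx).add (h'.deriv x hx)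
  ac_deriv := h.ac_deriv.add h'.ac_deriv
  deriv_deriv := by
    filter_upwards [Lp.coeFn_add w w', h.deriv_deriv, h'.deriv_deriv] with x hx h1 h2
    rw [hx]
    exact h1.add h2

theorem IsH2Rep.smul {s : Set ℝ} {ψ w : Lp ℂ 2 (volume.restrict s)} {u v : ℝ → ℂ} (c : ℂ)
    (h : IsH2Rep s ψ u v w) : IsH2Rep s (c • ψ) (c • u) (c • v) (c • w) where
  ae_eq := (Lp.coeFn_smul _ _).trans (h.ae_eq.const_smul c)
  ac := h.ac.const_smul c
  deriv x hx := (h.deriv x hx).const_smul c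
  ac_deriv := h.ac_deriv.const_smul c
  deriv_deriv := by
    filter_upwards [Lp.coeFn_smul c w, h.deriv_deriv] with x hx h1
    rw [hx]
    exact h1.const_smul c

/-- The second derivative is determined by the class of the function. -/
theorem IsH2Rep.eq_zero {s : Set ℝ} (hs : s ⊆ closure (interior s)) (hu : UniqueDiffOn ℝ s)
    (hm : MeasurableSet s) {w : Lp ℂ 2 (volume.restrict s)} {u v : ℝ → ℂ}
    (h : IsH2Rep s 0 u v w) : w = 0 := by
  have h0 : u =ᵐ[volume.restrict s] fun _ => (0 : ℂ) :=
    h.ae_eq.symm.trans (Lp.coeFn_zero _ _ _)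
  have hu0 : EqOn u (fun _ => 0) s :=
    Measure.eqOn_of_ae_eq h0 (fun x hx => (h.deriv x hx).continuousWithinAt)
      continuousOn_const hs
  have hv0 : ∀ x ∈ s, v x = 0 := fun x hx =>
    (hu x hx).eq_deriv s (h.deriv x hx)
      ((hasDerivWithinAt_const x s (0 : ℂ)).congr (fun y hy => hu0 hy) (hu0 hx))
  refine Lp.ext ?_
  filter_upwards [h.deriv_deriv, Lp.coeFn_zero ℂ 2 (volume.restrict s),
    ae_restrict_mem hm] with x h1 h2 hx
  rw [h2]
  exact (hu x hx).eq_deriv s h1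
    ((hasDerivWithinAt_const x s (0 : ℂ)).congr (fun y hy => hv0 y hy) (hv0 x hx))

namespace SignedMetricGraph

variable {V E I : Type*}

/-- The vector of the boundary values of a function `u` on the graph. -/
def trace (G : SignedMetricGraph V E I) (u : E ⊕ I → ℝ → ℂ) : BoundarySpace E I :=
  WithLp.toLp 2 (Sum.elim (fun e => u (Sum.inl e) 0)
    (Sum.elim (fun i => u (Sum.inr i) 0) (fun i => u (Sum.inr i) (G.a i))))

/-- The vector of the inward boundary values of a derivative `v` on the graph. -/
def dtrace (G : SignedMetricGraph V E I) (v : E ⊕ I → ℝ → ℂ) : BoundarySpace E I :=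
  WithLp.toLp 2 (Sum.elim (fun e => v (Sum.inl e) 0)
    (Sum.elim (fun i => v (Sum.inr i) 0) (fun i => -v (Sum.inr i) (G.a i))))

theorem trace_add (G : SignedMetricGraph V E I) (u u' : E ⊕ I → ℝ → ℂ) :
    G.trace (u + u') = G.trace u + G.trace u' := by
  ext k; rcases k with e | i | i <;> simp [trace]

theorem trace_smul (G : SignedMetricGraph V E I) (c : ℂ) (u : E ⊕ I → ℝ → ℂ) :
    G.trace (c • u) = c • G.trace u := by
  ext k; rcases k with e | i | i <;> simp [trace]

theorem dtrace_add (G : SignedMetricGraph V E I) (u u' : E ⊕ I → ℝ → ℂ) :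
    G.dtrace (u + u') = G.dtrace u + G.dtrace u' := by
  ext k; rcases k with e | i | i <;> simp [dtrace]; ring

theorem dtrace_smul (G : SignedMetricGraph V E I) (c : ℂ) (u : E ⊕ I → ℝ → ℂ) :
    G.dtrace (c • u) = c • G.dtrace u := by
  ext k; rcases k with e | i | i <;> simp [dtrace]

theorem interval_facts (G : SignedMetricGraph V E I) (j : E ⊕ I) :
    G.interval j ⊆ closure (interior (G.interval j)) ∧ UniqueDiffOn ℝ (G.interval j) ∧
      MeasurableSet (G.interval j) := by
  rcases j with e | i
  · exact ⟨by simp [interval], uniqueDiffOn_Ici 0, measurableSet_Ici⟩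
  · exact ⟨(closure_interior_Icc (G.a_pos i).ne).symm.subset, uniqueDiffOn_Icc (G.a_pos i),
      measurableSet_Icc⟩

variable [Fintype E] [Fintype I]

/-- The graph of `T(A, B)`: the pairs `(ψ, τ ψ)`, where each `ψⱼ` and its derivative are absolutely
continuous with `ψⱼ'' ∈ L²`, where `(τ ψ)ⱼ = -ψⱼ''` on positive edges and `(τ ψ)ⱼ = ψⱼ''` on
negative ones, and where the boundary values `ψ̲`, `ψ̲'` satisfy `A ψ̲ + B ψ̲' = 0`. -/
def opGraph (G : SignedMetricGraph V E I) (A B : BoundarySpace E I →ₗ[ℂ] BoundarySpace E I) :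
    Submodule ℂ (G.Hilb × G.Hilb) where
  carrier := {p | ∃ (u v : E ⊕ I → ℝ → ℂ) (w : G.Hilb),
    (∀ j, IsH2Rep (G.interval j) (p.1 j) (u j) (v j) (w j)) ∧
    (∀ j, p.2 j = -(((G.sgn j : ℤ) : ℂ) • w j)) ∧
    A (G.trace u) + B (G.dtrace v) = 0}
  zero_mem' := by
    refine ⟨0, 0, 0, fun j => IsH2Rep.zero _, fun j => by simp, ?_⟩
    have h1 : G.trace 0 = 0 := by ext k; rcases k with e | i | i <;> simp [trace]
    have h2 : G.dtrace 0 = 0 := by ext k; rcases k with e | i | i <;> simp [dtrace]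
    simp [h1, h2]
  add_mem' := by
    rintro p q ⟨u, v, w, h1, h2, h3⟩ ⟨u', v', w', h1', h2', h3'⟩
    refine ⟨u + u', v + v', w + w', fun j => (h1 j).add (h1' j), fun j => ?_, ?_⟩
    · have : (p + q).2 j = p.2 j + q.2 j := rfl
      rw [this, h2 j, h2' j, PiLp.add_apply, smul_add, neg_add]
    · rw [trace_add, dtrace_add, map_add, map_add, add_add_add_comm, h3, h3', add_zero]
  smul_mem' := by
    rintro c p ⟨u, v, w, h1, h2, h3⟩
    refine ⟨c • u, c • v, c • w, fun j => (h1 j).smul c, fun j => ?_, ?_⟩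
    · have : (c • p).2 j = c • p.2 j := rfl
      rw [this, h2 j, PiLp.smul_apply, smul_neg, smul_comm]
    · rw [trace_smul, dtrace_smul, map_smul, map_smul, ← smul_add, h3, smul_zero]

/-- The operator `T(A, B)` in the Hilbert space of the graph. -/
def op (G : SignedMetricGraph V E I) (A B : BoundarySpace E I →ₗ[ℂ] BoundarySpace E I) :
    G.Hilb →ₗ.[ℂ] G.Hilb :=
  (G.opGraph A B).toLinearPMap

theorem op_graph (G : SignedMetricGraph V E I)
    (A B : BoundarySpace E I →ₗ[ℂ] BoundarySpace E I) : (G.op A B).graph = G.opGraph A B := by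
  refine Submodule.toLinearPMap_graph_eq _ ?_
  rintro ⟨ψ, φ⟩ ⟨u, v, w, h1, h2, -⟩ (h : ψ = 0)
  subst h
  obtain rfl : w = 0 := by
    ext1 j
    exact (h1 j).eq_zero (G.interval_facts j).1 (G.interval_facts j).2.1 (G.interval_facts j).2.2
  ext1 j
  have := h2 j
  simpa using this

end SignedMetricGraph

/-- The space of all `ψ` in the domain of `T` with `T ψ = μ ψ`. -/
def LinearPMap.eigenspaceAt {H : Type*} [AddCommGroup H] [Module ℂ H] (T : H →ₗ.[ℂ] H) (μ : ℂ) :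
    Submodule ℂ H :=
  T.graph.comap (LinearMap.prod LinearMap.id (μ • LinearMap.id))

theorem LinearPMap.mem_eigenspaceAt_iff {H : Type*} [AddCommGroup H] [Module ℂ H]
    (T : H →ₗ.[ℂ] H) (μ : ℂ) (ψ : H) :
    ψ ∈ T.eigenspaceAt μ ↔ ∃ h : ψ ∈ T.domain, T ⟨ψ, h⟩ = μ • ψ := by
  simp [LinearPMap.eigenspaceAt, LinearPMap.mem_graph_iff]

/-- The counting function of the eigenvalues of sign `s`: the number, with multiplicities, of the
eigenvalues `s * t` of `T` with `0 < t < lam` (so `s = 1` gives `N₊`, `s = -1` gives `N₋`).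
The value is `∞` if there are infinitely many or if a multiplicity is infinite. -/
def LinearPMap.countEigenvalues {H : Type*} [AddCommGroup H] [Module ℂ H] (T : H →ₗ.[ℂ] H)
    (s : ℤˣ) (lam : ℝ) : ENNReal :=
  ∑' t : Ioo (0 : ℝ) lam,
    ((Module.rank ℂ (T.eigenspaceAt (((s : ℤ) : ℂ) * ((t : ℝ) : ℂ)))).toENat : ENNReal)

/-- The Weyl law for the eigenvalues of sign `s`: the counting function is finite, and
`N(lam) ∼ c * lam ^ (1 / 2)` as `lam → ∞` with `c` the total length of the internal edges of
sign `s` divided by `π`, in the sense that `N(lam) / lam ^ (1 / 2)` tends to `c`. -/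
def SignedMetricGraph.WeylLaw {V E I : Type*} [Fintype E] [Fintype I]
    (G : SignedMetricGraph V E I) (A B : BoundarySpace E I →ₗ[ℂ] BoundarySpace E I)
    (s : ℤˣ) : Prop :=
  (∀ lam : ℝ, (G.op A B).countEigenvalues s lam ≠ ⊤) ∧
    Tendsto (fun lam : ℝ => ((G.op A B).countEigenvalues s lam).toReal / lam ^ (1 / 2 : ℝ)) atTop
      (𝓝 (1 / Real.pi * ∑ i ∈ G.intEdges s, G.a i))

end

/-!
The eigenvalues of `T = T(A, B)` of sign `s` below `lam` in absolute value are those in the interval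
of radius `r = lam / 2` around `c = s lam / 2`. They are counted by comparing `T` with the operator
`τ` under periodic boundary conditions on the internal edges of sign `s`, whose eigenvalues there
are `s κ²` with the frequencies `κ = 2 π n / aᵢ`, `n ∈ ℤ`; about `(aᵢ / π) lam ^ (1 / 2)` of them
lie below `lam`. Passing between the two operators costs only the finite number of boundary
conditions, a bounded error.

*Upper bound.* Let all boundary values of `ψ` and `ψ'` vanish, and let `ψ` be orthogonal to the
exponential functions with `κ² < lam` on the edges of sign `s`. Then `‖(T - c) ψ‖ ≥ r ‖ψ‖`: on the
edges of sign `s` by Parseval's identity (`IsH2Rep.le_norm_add`), and on the other edges, among them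
all external ones, because `s τ ≤ 0` there (`IsH2Rep.re_inner_nonpos_of_Icc`,
`IsH2Rep.re_inner_nonpos_of_Ici`). Nonzero sums of eigenvectors with eigenvalues in the interval
satisfy the opposite strict inequality, so their dimension is at most the codimension of the space
of these `ψ` (`IsSelfAdjoint.sum_finrank_eigenspaceAt_le`).

*Lower bound.* Trigonometric polynomials with `0 < κ² < lam` on the edges of sign `s` and with
vanishing boundary values satisfy `‖(T - c) ψ‖ < r ‖ψ‖`. They inject into the span `M` of the
eigenvectors, provided that `‖(T - c) ψ‖ ≥ r ‖ψ‖` on the orthogonal complement of `M`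
(`IsSelfAdjoint.exists_finrank_le_sum`). This is where self-adjointness enters, through the absence
of essential spectrum in the interval: the bounded operator `(1 + (T - c)²)⁻¹`, compressed to `Mᗮ`,
is at most `β₀ = (1 + r²)⁻¹` on a subspace of finite codimension. Hence for `|β| > β₀` its difference
with `β` has closed range, and is invertible if `β` is not an eigenvalue; an eigenvalue `β` would
produce eigenvectors of `T` in `Mᗮ`. So its norm, the spectral radius, is at most `β₀`
(`ContinuousLinearMap.norm_le_of_norm_le_on_ker`,
`Submodule.le_norm_snd_of_orthogonal_eigenvectors`).
-/

open scoped InnerProductSpace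

/-! ### Finite-codimensional bounds for self-adjoint operators -/

section FiniteCodim

variable {H : Type*} [NormedAddCommGroup H] [InnerProductSpace ℂ H] [CompleteSpace H]
variable {V : Type*} [AddCommGroup V] [Module ℂ V] [FiniteDimensional ℂ V]

/-- An operator that is bounded below on the kernel of a linear map of finite rank has closed range.
The map `Φ` need not be continuous: the bound extends to the closure of `ker Φ`. -/
theorem ContinuousLinearMap.isClosed_range_of_le_norm_on_ker (A : H →L[ℂ] H) (Φ : H →ₗ[ℂ] V)
    {δ : ℝ} (hδ : 0 < δ) (h : ∀ x, Φ x = 0 → δ * ‖x‖ ≤ ‖A x‖) :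
    IsClosed (A.toLinearMap.range : Set H) := by
  set S : Submodule ℂ H := (LinearMap.ker Φ).topologicalClosure with hS
  have hfin : S.CoFG := by
    have h1 : (LinearMap.ker Φ).CoFG := by
      refine Module.Finite.equiv Φ.quotKerEquivRange.symm
    exact h1.of_le (Submodule.le_topologicalClosure _)
  have hb : ∀ x ∈ S, δ * ‖x‖ ≤ ‖A x‖ := by
    intro x hx
    have hcl : IsClosed {x : H | δ * ‖x‖ ≤ ‖A x‖} :=
      isClosed_le (by fun_prop) (by fun_prop)
    exact closure_minimal (s := (LinearMap.ker Φ : Set H)) (fun y hy => h y hy) hcl hx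
  have hanti : AntilipschitzWith (Real.toNNReal δ⁻¹) (A.comp S.subtypeL) := by
    refine AddMonoidHomClass.antilipschitz_of_bound _ fun x => ?_
    rw [Real.coe_toNNReal _ (inv_nonneg.2 hδ.le), ← div_eq_inv_mul, le_div_iff₀ hδ, mul_comm]
    exact hb x x.2
  have hScl : IsClosed (S : Set H) := Submodule.isClosed_topologicalClosure _
  have : CompleteSpace S := hScl.completeSpace_coe
  have hcl : IsClosed (Set.range (A.comp S.subtypeL)) :=
    hanti.isClosed_range (A.comp S.subtypeL).uniformContinuous
  refine LinearMap.isClosed_range_of_isClosed_map_of_finiteDimensional_quotient (s := S) ?_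
  convert hcl using 1
  ext y
  simp

/-- A bounded self-adjoint operator that is bounded by `β₀` on a subspace of finite codimension
has only eigenvalues as spectrum outside `[-β₀, β₀]`; so if there are no such eigenvalues, its norm
is at most `β₀`. -/
theorem ContinuousLinearMap.norm_le_of_norm_le_on_ker (B : H →L[ℂ] H) (hB : IsSelfAdjoint B)
    (Φ : H →ₗ[ℂ] V) {β₀ : ℝ} (h0 : 0 ≤ β₀) (hΦ : ∀ x, Φ x = 0 → ‖B x‖ ≤ β₀ * ‖x‖)
    (he : ∀ β : ℝ, β₀ < |β| → ∀ x, B x = (β : ℂ) • x → x = 0) : ‖B‖ ≤ β₀ := by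
  have hspec : ∀ z ∈ spectrum ℂ B, ‖z‖ ≤ β₀ := by
    intro z hz
    by_contra! hlt
    obtain ⟨β, rfl⟩ : ∃ β : ℝ, z = β := ⟨z.re, hB.mem_spectrum_eq_re hz⟩
    rw [Complex.norm_real, Real.norm_eq_abs] at hlt
    refine hz ?_
    change IsUnit _
    set A : H →L[ℂ] H := algebraMap ℂ (H →L[ℂ] H) (β : ℂ) - B with hA
    have hAx : ∀ x, A x = (β : ℂ) • x - B x := fun x => by
      simp [hA, Algebra.algebraMap_eq_smul_one]
    have hAsa : IsSelfAdjoint A := by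
      refine IsSelfAdjoint.sub ?_ hB
      rw [Algebra.algebraMap_eq_smul_one]
      exact IsSelfAdjoint.smul (by simp [IsSelfAdjoint, Complex.conj_ofReal]) (IsSelfAdjoint.one _)
    have hker : ∀ x, A x = 0 → x = 0 := fun x hx => he β hlt x (by
      rw [hAx, sub_eq_zero] at hx; exact hx.symm)
    have hcl : IsClosed (A.toLinearMap.range : Set H) := by
      refine A.isClosed_range_of_le_norm_on_ker Φ (sub_pos.2 hlt) fun x hx => ?_
      have h1 : ‖(β : ℂ) • x‖ - ‖B x‖ ≤ ‖A x‖ := by rw [hAx]; exact norm_sub_norm_le _ _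
      rw [norm_smul, Complex.norm_real, Real.norm_eq_abs] at h1
      have := hΦ x hx
      nlinarith
    rw [ContinuousLinearMap.isUnit_iff_bijective]
    refine ⟨(injective_iff_map_eq_zero A).2 hker, ?_⟩
    have horth : (A.toLinearMap.range)ᗮ = ⊥ := by
      rw [Submodule.eq_bot_iff]
      intro y hy
      refine hker y ?_
      refine ext_inner_left ℂ fun x => ?_
      rw [inner_zero_right]
      have := (Submodule.mem_orthogonal _ _).1 hy (A x) ⟨x, rfl⟩
      rwa [← hAsa.adjoint_eq, ContinuousLinearMap.adjoint_inner_right]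
    have : CompleteSpace A.toLinearMap.range := hcl.completeSpace_coe
    have htop := (Submodule.orthogonal_eq_bot_iff).1 horth
    exact LinearMap.range_eq_top.1 htop
  have hr := hB.spectralRadius_eq_nnnorm
  have hle : spectralRadius ℂ B ≤ ENNReal.ofReal β₀ := by
    refine iSup₂_le fun z hz => ?_
    have h2 := ENNReal.ofReal_le_ofReal (hspec z hz)
    rwa [ofReal_norm] at h2
  rw [hr] at hle
  have h3 : ENNReal.ofReal ‖B‖ ≤ ENNReal.ofReal β₀ := by
    rwa [ofReal_norm]
  exact (ENNReal.ofReal_le_ofReal_iff h0).1 h3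

/-- For a closed operator `T` with graph `Γ`, the bounded operator `B = (1 + T* T)⁻¹`, obtained from
the orthogonal projection of `(x, 0)` to `Γ`. The second component of that projection is `T B x`. -/
theorem Submodule.exists_graph_resolvent (Γ : Submodule ℂ (H × H)) (hΓ : IsClosed (Γ : Set (H × H))) :
    ∃ (Q : H →ₗ[ℂ] Γ) (B : H →L[ℂ] H), IsSelfAdjoint B ∧ (∀ x, (Q x).1.1 = B x) ∧
      ∀ x, ∀ p ∈ Γ, ⟪p.1, x - B x⟫_ℂ = ⟪p.2, (Q x).1.2⟫_ℂ := by
  set e := WithLp.linearEquiv 2 ℂ (H × H) with he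
  set Γ' : Submodule ℂ (WithLp 2 (H × H)) := Γ.comap e.toLinearMap with hΓ'
  have hcl : IsClosed (Γ' : Set (WithLp 2 (H × H))) :=
    hΓ.preimage (WithLp.prod_continuous_ofLp 2 H H)
  have : CompleteSpace Γ' := hcl.completeSpace_coe
  set Q : H →ₗ[ℂ] Γ :=
    { toFun := fun x => ⟨e (Γ'.orthogonalProjectionOnto (e.symm (x, 0))), by
        exact (Γ'.orthogonalProjectionOnto (e.symm (x, 0))).2⟩
      map_add' := fun x y => by
        have : ((x + y, 0) : H × H) = (x, 0) + (y, 0) := by simp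
        simp only [this, map_add, Submodule.coe_add]
        rfl
      map_smul' := fun c x => by
        have : ((c • x, 0) : H × H) = c • (x, 0) := by simp
        simp only [this, map_smul, Submodule.coe_smul]
        rfl } with hQ
  have key : ∀ x, ∀ p ∈ Γ, ⟪p.1, x - (Q x).1.1⟫_ℂ = ⟪p.2, (Q x).1.2⟫_ℂ := by
    intro x p hp
    have h1 := Γ'.inner_right_of_mem_orthogonal (u := e.symm p) (by simpa [hΓ'] using hp)
      (Γ'.sub_starProjection_mem_orthogonal (e.symm (x, 0)))
    rw [WithLp.prod_inner_apply] at h1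
    have h2 : ⟪p.1, x - (Q x).1.1⟫_ℂ + ⟪p.2, 0 - (Q x).1.2⟫_ℂ = 0 := h1
    rw [zero_sub, inner_neg_right] at h2
    exact add_neg_eq_zero.1 h2
  have hsymm : ∀ x y, ⟪(Q x).1.1, y⟫_ℂ = ⟪x, (Q y).1.1⟫_ℂ := by
    intro x y
    have h1 := key y _ (Q x).2
    have h2 := congrArg (starRingEnd ℂ) (key x _ (Q y).2)
    rw [inner_conj_symm, inner_conj_symm, inner_sub_left] at h2
    rw [inner_sub_right] at h1
    linear_combination h1 - h2
  have hbd : ∀ x, ‖(Q x).1.1‖ ≤ 1 * ‖x‖ := by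
    intro x
    have h1 := key x _ (Q x).2
    rw [inner_sub_right, inner_self_eq_norm_sq_to_K, inner_self_eq_norm_sq_to_K] at h1
    have h2 : ‖(Q x).1.1‖ ^ 2 ≤ ‖(Q x).1.1‖ * ‖x‖ := by
      have h3 := norm_inner_le_norm (𝕜 := ℂ) (Q x).1.1 x
      have h4 : ⟪(Q x).1.1, x⟫_ℂ = ((‖(Q x).1.1‖ ^ 2 + ‖(Q x).1.2‖ ^ 2 : ℝ) : ℂ) := by
        push_cast
        linear_combination h1
      rw [h4, Complex.norm_real, Real.norm_of_nonneg (by positivity)] at h3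
      nlinarith [sq_nonneg ‖(Q x).1.2‖]
    rw [one_mul]
    by_contra! hlt
    nlinarith [norm_nonneg x]
  set B : H →L[ℂ] H := LinearMap.mkContinuous
    ((LinearMap.fst ℂ H H).comp (Γ.subtype.comp Q)) 1 hbd with hBdef
  refine ⟨Q, B, ?_, fun x => rfl, key⟩
  rw [ContinuousLinearMap.isSelfAdjoint_iff_isSymmetric]
  exact hsymm

/-- The bound `r ‖x‖ ≤ ‖T x‖` for a self-adjoint operator with graph `Γ`, known on a subspace of
finite codimension of the domain, holds on the orthogonal complement of the eigenvectors
with eigenvalues in `(-r, r)`. -/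
theorem Submodule.le_norm_snd_of_orthogonal_eigenvectors (Γ : Submodule ℂ (H × H))
    (hΓ : Γ.adjoint = Γ) (Φ : Γ →ₗ[ℂ] V) {r : ℝ} (hr : 0 < r)
    (hΦ : ∀ p : Γ, Φ p = 0 → r * ‖p.1.1‖ ≤ ‖p.1.2‖) (M : Submodule ℂ H)
    (hM : M = Submodule.span ℂ {x | ∃ μ : ℝ, |μ| < r ∧ (x, (μ : ℂ) • x) ∈ Γ})
    {p : H × H} (hp : p ∈ Γ) (hpM : p.1 ∈ Mᗮ) : r * ‖p.1‖ ≤ ‖p.2‖ := by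
  have hmem : ∀ f g : H, (∀ p ∈ Γ, ⟪p.2, f⟫_ℂ = ⟪p.1, g⟫_ℂ) → (f, g) ∈ Γ := by
    intro f g h
    rw [← hΓ, Submodule.mem_adjoint_iff]
    intro a b hab
    exact sub_eq_zero.2 (h (a, b) hab)
  have hsym : ∀ p ∈ Γ, ∀ q ∈ Γ, ⟪p.2, q.1⟫_ℂ = ⟪p.1, q.2⟫_ℂ := by
    intro p hp q hq
    rw [← hΓ, Submodule.mem_adjoint_iff] at hq
    exact sub_eq_zero.1 (hq p.1 p.2 hp)
  have hclosed : IsClosed (Γ : Set (H × H)) := by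
    have : (Γ : Set (H × H)) = ⋂ p ∈ Γ, {q : H × H | ⟪p.2, q.1⟫_ℂ = ⟪p.1, q.2⟫_ℂ} := by
      ext q
      simp only [mem_iInter]
      exact ⟨fun hq p hp => hsym p hp q hq, fun h => hmem q.1 q.2 h⟩
    rw [this]
    exact isClosed_biInter fun p _ => isClosed_eq (by fun_prop) (by fun_prop)
  obtain ⟨Q, B, hB, hQB, hQ⟩ := Γ.exists_graph_resolvent hclosed
  have hBsym : ∀ x y, ⟪B x, y⟫_ℂ = ⟪x, B y⟫_ℂ :=
    (ContinuousLinearMap.isSelfAdjoint_iff_isSymmetric.1 hB)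
  -- `‖B x‖² + ‖T B x‖² = ⟪B x, x⟫`
  have hnorm : ∀ x, ⟪B x, x⟫_ℂ = ((‖B x‖ ^ 2 + ‖(Q x).1.2‖ ^ 2 : ℝ) : ℂ) := by
    intro x
    have h1 := hQ x _ (Q x).2
    rw [hQB, inner_sub_right, inner_self_eq_norm_sq_to_K, inner_self_eq_norm_sq_to_K] at h1
    push_cast
    linear_combination h1
  have hQmem : ∀ x, (B x, (Q x).1.2) ∈ Γ := fun x => by
    rw [← hQB]; exact (Q x).2
  have hQ2 : ∀ x, ((Q x).1.2, x - B x) ∈ Γ := fun x =>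
    hmem _ _ fun p hp => (hQ x p hp).symm
  have hBeig : ∀ (μ : ℝ) (x : H), (x, (μ : ℂ) • x) ∈ Γ →
      B x = ((1 + μ ^ 2 : ℝ) : ℂ)⁻¹ • x := by
    intro μ x hx
    have hne : ((1 + μ ^ 2 : ℝ) : ℂ) ≠ 0 := by
      exact_mod_cast (by positivity : (1 + μ ^ 2 : ℝ) ≠ 0)
    rw [eq_inv_smul_iff₀ hne]
    refine ext_inner_right ℂ fun z => ?_
    have h1 := hQ z _ hx
    have h2 := hsym _ hx _ (hQmem z)
    have h3 : ⟪B x, z⟫_ℂ = ⟪x, B z⟫_ℂ := hBsym x z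
    simp only [inner_smul_left, inner_sub_right, Complex.conj_ofReal] at h1 h2 ⊢
    rw [h3]
    push_cast
    linear_combination -h1 + μ * h2
  have hMorth : ∀ x, x ∈ Mᗮ ↔ ∀ y, (∃ μ : ℝ, |μ| < r ∧ (y, (μ : ℂ) • y) ∈ Γ) → ⟪y, x⟫_ℂ = 0 := by
    intro x
    refine ⟨fun hx y hy => (Submodule.mem_orthogonal _ _).1 hx y
      (hM ▸ Submodule.subset_span hy), fun h => ?_⟩
    rw [Submodule.mem_orthogonal, hM]
    intro y hy
    induction hy using Submodule.span_induction with
    | mem y hy => exact h y hy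
    | zero => exact inner_zero_left _
    | add y z _ _ h1 h2 => rw [inner_add_left, h1, h2, add_zero]
    | smul c y _ h1 => rw [inner_smul_left, h1, mul_zero]
  -- `B` leaves `Mᗮ` invariant
  have hBM : ∀ x ∈ Mᗮ, B x ∈ Mᗮ := by
    intro x hx
    rw [hMorth] at hx ⊢
    rintro y ⟨μ, hμ, hy⟩
    rw [← hBsym, hBeig μ y hy, inner_smul_left, hx y ⟨μ, hμ, hy⟩, mul_zero]
  have hdisj : ∀ x ∈ M, x ∈ Mᗮ → x = 0 := fun x h1 h2 => by
    have := Submodule.inner_right_of_mem_orthogonal h1 h2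
    exact inner_self_eq_zero.1 this
  set P : H →L[ℂ] H := Mᗮ.starProjection with hPdef
  have hPsa : IsSelfAdjoint P := isSelfAdjoint_starProjection _
  set β₀ : ℝ := (1 + r ^ 2)⁻¹ with hβ₀
  have hβpos : 0 < β₀ := by positivity
  have hβr : β₀ * (1 + r ^ 2) = 1 := inv_mul_cancel₀ (by positivity)
  have hB' : ‖P * B * P‖ ≤ β₀ := by
    -- compressing by `P` removes the eigenvectors in `M`; no finite dimension of `M` is needed
    refine ContinuousLinearMap.norm_le_of_norm_le_on_ker _ ?_ (Φ ∘ₗ Q ∘ₗ P.toLinearMap) hβpos.le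
      ?_ ?_
    · have := hB.conjugate_self hPsa
      exact this
    · intro x hx
      have h1 : Φ (Q (P x)) = 0 := hx
      have h2 := hΦ _ h1
      rw [hQB] at h2
      have h3 : ‖P (B (P x))‖ ≤ ‖B (P x)‖ := Submodule.norm_starProjection_apply_le _ _
      have h4 : ‖P x‖ ≤ ‖x‖ := Submodule.norm_starProjection_apply_le _ _
      have h5 : ‖B (P x)‖ ≤ β₀ * ‖P x‖ := by
        have h6 := norm_inner_le_norm (𝕜 := ℂ) (B (P x)) (P x)
        rw [hnorm, Complex.norm_real, Real.norm_of_nonneg (by positivity)] at h6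
        have h7 : (r * ‖B (P x)‖) ^ 2 ≤ ‖(Q (P x)).1.2‖ ^ 2 := by gcongr
        have h8 : (1 + r ^ 2) * ‖B (P x)‖ ≤ ‖P x‖ := by
          by_contra! hlt
          have h9 : 0 < ‖B (P x)‖ := by
            by_contra! h10
            have : ‖B (P x)‖ = 0 := le_antisymm h10 (norm_nonneg _)
            rw [this] at hlt
            linarith [norm_nonneg (P x)]
          nlinarith
        rw [hβ₀, ← div_eq_inv_mul, le_div_iff₀ (by positivity)]
        linarith
      calc ‖(P * B * P) x‖ = ‖P (B (P x))‖ := rfl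
        _ ≤ β₀ * ‖P x‖ := h3.trans h5
        _ ≤ β₀ * ‖x‖ := by gcongr
    · intro β hβ x hx
      have hβne : (β : ℂ) ≠ 0 := by
        intro h0
        rw [Complex.ofReal_eq_zero] at h0
        simp [h0] at hβ
        linarith
      have hxM : x ∈ Mᗮ := by
        have h1 : P (B (P x)) ∈ Mᗮ := Submodule.starProjection_apply_mem _ _
        have h2 : P (B (P x)) = (β : ℂ) • x := hx
        rw [h2] at h1
        exact (Submodule.smul_mem_iff _ hβne).1 h1
      have hPx : P x = x := Submodule.starProjection_eq_self_iff.2 hxM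
      have hBx : B x = (β : ℂ) • x := by
        have h2 : P (B (P x)) = (β : ℂ) • x := hx
        rwa [hPx, Submodule.starProjection_eq_self_iff.2 (hBM x hxM)] at h2
      by_contra hx0
      have hxpos : 0 < ‖x‖ := norm_pos_iff.2 hx0
      -- `0 < β ≤ 1`
      have h1 := hnorm x
      rw [hBx, inner_smul_left, Complex.conj_ofReal, inner_self_eq_norm_sq_to_K, norm_smul,
        Complex.norm_real, Real.norm_eq_abs] at h1
      have h2 : β * ‖x‖ ^ 2 = (|β| * ‖x‖) ^ 2 + ‖(Q x).1.2‖ ^ 2 := by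
        have h3 : ((β * ‖x‖ ^ 2 : ℝ) : ℂ) =
            (((|β| * ‖x‖) ^ 2 + ‖(Q x).1.2‖ ^ 2 : ℝ) : ℂ) := by
          rw [← h1]; push_cast; rfl
        exact Complex.ofReal_injective h3
      have hβ0 : 0 < β := by
        have : 0 < β * ‖x‖ ^ 2 := by
          rw [h2]
          have : 0 < |β| := hβpos.trans hβ
          positivity
        exact pos_of_mul_pos_left this (by positivity)
      rw [abs_of_pos hβ0] at hβ h2
      have hβ1 : β ≤ 1 := by
        have : β * β * ‖x‖ ^ 2 ≤ β * ‖x‖ ^ 2 := by nlinarith [sq_nonneg ‖(Q x).1.2‖]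
        have h3 : 0 < β * ‖x‖ ^ 2 := by positivity
        by_contra! h4
        nlinarith
      obtain ⟨m, hm0, hm⟩ : ∃ m : ℝ, 0 ≤ m ∧ m ^ 2 * β = 1 - β :=
        ⟨Real.sqrt ((1 - β) / β), Real.sqrt_nonneg _, by
          rw [Real.sq_sqrt (div_nonneg (by linarith) hβ0.le), div_mul_cancel₀ _ hβ0.ne']⟩
      have hmr : m < r := by
        by_contra! hle
        have : r ^ 2 ≤ m ^ 2 := by gcongr
        nlinarith
      have hmC : (m : ℂ) ^ 2 * β = 1 - β := by exact_mod_cast hm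
      set q := (Q x).1.2 with hq
      have hg1 : ((β : ℂ) • x, q) ∈ Γ := by rw [← hBx]; exact hQmem x
      have hg2 : (q, (1 - (β : ℂ)) • x) ∈ Γ := by
        have := hQ2 x
        rwa [hBx, show x - (β : ℂ) • x = (1 - (β : ℂ)) • x by rw [sub_smul, one_smul]] at this
      have hqM : q ∈ Mᗮ := by
        rw [hMorth]
        rintro y ⟨μ, hμ, hy⟩
        have h4 := hsym _ hy _ hg1
        have hxy : ⟪y, x⟫_ℂ = 0 := by
          rw [hMorth] at hxM
          exact hxM y ⟨μ, hμ, hy⟩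
        simp only [inner_smul_left, inner_smul_right, hxy, mul_zero] at h4
        exact h4.symm
      -- `T B x ± m B x` are eigenvectors of `T` with the eigenvalues `± m`
      have hw : ∀ ε : ℝ, |ε| = m → q + (ε : ℂ) • ((β : ℂ) • x) = 0 := by
        intro ε hε
        have hε2 : (ε : ℂ) ^ 2 * β = 1 - β := by
          rw [← hmC, ← hε]
          norm_cast
          rw [sq_abs]
        refine hdisj _ ?_ (Submodule.add_mem _ hqM
          (Submodule.smul_mem _ _ (Submodule.smul_mem _ _ hxM)))
        rw [hM]
        refine Submodule.subset_span ⟨ε, by rw [hε]; exact hmr, ?_⟩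
        have h5 := Γ.add_mem hg2 (Γ.smul_mem (ε : ℂ) hg1)
        convert h5 using 1
        refine Prod.ext rfl ?_
        simp only [Prod.snd_add, Prod.smul_snd]
        rw [smul_add, add_comm]
        congr 1
        rw [smul_smul, smul_smul]
        congr 1
        linear_combination hε2
      have hplus := hw m (abs_of_nonneg hm0)
      have hminus := hw (-m) (by rw [abs_neg, abs_of_nonneg hm0])
      have hq0 : q = 0 := by
        have h6 : (2 : ℂ) • q = 0 := by
          have := congrArg₂ (· + ·) hplus hminus
          simp only [Complex.ofReal_neg, neg_smul, add_zero] at this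
          rw [two_smul, ← this]
          abel
        simpa using h6
      refine hx0 ?_
      have h7 : (β : ℂ) • x = 0 := by
        refine hdisj _ ?_ (Submodule.smul_mem _ _ hxM)
        rw [hM]
        refine Submodule.subset_span ⟨0, by simpa using hr, ?_⟩
        simpa [hq0] using hg1
      exact (smul_eq_zero.1 h7).resolve_left hβne
  -- the bound for `B` on `Mᗮ` gives the bound for `T` by the Cauchy-Schwarz inequality in `Γ`
  set x := p.1 with hx
  have hPx : P x = x := Submodule.starProjection_eq_self_iff.2 hpM
  have hBx : ‖B x‖ ≤ β₀ * ‖x‖ := by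
    have h1 := (P * B * P).le_opNorm x
    have h2 : (P * B * P) x = B x := by
      change P (B (P x)) = B x
      rw [hPx, Submodule.starProjection_eq_self_iff.2 (hBM x hpM)]
    rw [h2] at h1
    exact h1.trans (by gcongr)
  set b := ‖B x‖ with hb
  set t := ‖(Q x).1.2‖ with ht
  have h1 : b ^ 2 + t ^ 2 ≤ b * ‖x‖ := by
    have h2 := norm_inner_le_norm (𝕜 := ℂ) (B x) x
    rw [hnorm, Complex.norm_real, Real.norm_of_nonneg (by positivity)] at h2
    exact h2
  have h2 : ‖x‖ ^ 2 ≤ ‖x‖ * b + ‖p.2‖ * t := by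
    have h3 := hQ x p hp
    have h4 : ⟪x, x⟫_ℂ = ⟪x, B x⟫_ℂ + ⟪p.2, (Q x).1.2⟫_ℂ := by
      rw [← h3, inner_sub_right]; ring
    have h5 : ‖(⟪x, x⟫_ℂ : ℂ)‖ ≤ ‖x‖ * b + ‖p.2‖ * t := by
      rw [h4]
      exact (norm_add_le _ _).trans (add_le_add (norm_inner_le_norm _ _) (norm_inner_le_norm _ _))
    rwa [inner_self_eq_norm_sq_to_K, norm_pow, RCLike.norm_ofReal, abs_norm] at h5
  rcases (norm_nonneg x).eq_or_lt with h0 | h0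
  · rw [← h0, mul_zero]; exact norm_nonneg _
  have hβ1 : β₀ < 1 := by nlinarith
  have h3 : 0 < ‖x‖ - b := by nlinarith
  have h4 : ‖x‖ ^ 2 * (‖x‖ - b) ^ 2 ≤ ‖p.2‖ ^ 2 * t ^ 2 := by
    rw [← mul_pow, ← mul_pow]
    exact pow_le_pow_left₀ (by positivity) (by linarith) 2
  have h5 : ‖x‖ ^ 2 * (‖x‖ - b) ≤ ‖p.2‖ ^ 2 * b := by
    refine le_of_mul_le_mul_right ?_ h3
    have : ‖p.2‖ ^ 2 * t ^ 2 ≤ ‖p.2‖ ^ 2 * (b * (‖x‖ - b)) := by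
      gcongr; linarith
    linarith
  have h6 : ‖x‖ * (‖x‖ - b) ≤ ‖p.2‖ ^ 2 * β₀ := by
    refine le_of_mul_le_mul_right ?_ h0
    have : ‖p.2‖ ^ 2 * b ≤ ‖p.2‖ ^ 2 * (β₀ * ‖x‖) := by gcongr
    linarith
  have h7 : (r * ‖x‖) ^ 2 ≤ ‖p.2‖ ^ 2 := by
    refine le_of_mul_le_mul_right ?_ hβpos
    nlinarith
  exact le_of_sq_le_sq h7 (norm_nonneg _)

end FiniteCodim

/-! ### Counting eigenvalues by comparison of dimensions -/

section Counting

variable {H : Type*} [NormedAddCommGroup H] [InnerProductSpace ℂ H] {ι : Type*}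
variable {V : Type*} [AddCommGroup V] [Module ℂ V]
variable {W : Type*} [AddCommGroup W] [Module ℂ W]

theorem LinearPMap.mem_eigenspaceAt_iff_graph (T : H →ₗ.[ℂ] H) (μ : ℂ) (x : H) :
    x ∈ T.eigenspaceAt μ ↔ (x, μ • x) ∈ T.graph := Iff.rfl

/-- A sum of eigenvectors, as an element of the graph. -/
def LinearPMap.sumEigenvectors (T : H →ₗ.[ℂ] H) (μ : ι → ℝ) (F : Finset ι) :
    ((i : F) → T.eigenspaceAt (μ i : ℂ)) →ₗ[ℂ] T.graph where
  toFun x := ∑ i, ⟨((x i : H), (μ i : ℂ) • (x i : H)), (x i).2⟩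
  map_add' x y := by
    rw [← Finset.sum_add_distrib]
    refine Finset.sum_congr rfl fun i _ => Subtype.ext (Prod.ext rfl ?_)
    simp
  map_smul' a x := by
    rw [RingHom.id_apply, Finset.smul_sum]
    refine Finset.sum_congr rfl fun i _ => Subtype.ext (Prod.ext rfl ?_)
    simp [smul_comm a]

theorem LinearPMap.sumEigenvectors_fst (T : H →ₗ.[ℂ] H) (μ : ι → ℝ) (F : Finset ι)
    (x : (i : F) → T.eigenspaceAt (μ i : ℂ)) :
    (T.sumEigenvectors μ F x).1.1 = ∑ i, (x i : H) := by
  simp [sumEigenvectors, Prod.fst_sum]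

theorem LinearPMap.sumEigenvectors_snd (T : H →ₗ.[ℂ] H) (μ : ι → ℝ) (F : Finset ι)
    (x : (i : F) → T.eigenspaceAt (μ i : ℂ)) :
    (T.sumEigenvectors μ F x).1.2 = ∑ i : F, (μ i : ℂ) • (x i : H) := by
  rw [sumEigenvectors, LinearMap.coe_mk, AddHom.coe_mk, AddSubmonoidClass.coe_finsetSum,
    Prod.snd_sum]

variable [CompleteSpace H]

theorem IsSelfAdjoint.graph_adjoint {T : H →ₗ.[ℂ] H} (hT : IsSelfAdjoint T) :
    T.graph.adjoint = T.graph := by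
  rw [← LinearPMap.adjoint_graph_eq_graph_adjoint hT.dense_domain, LinearPMap.isSelfAdjoint_def.1 hT]

theorem IsSelfAdjoint.inner_graph {T : H →ₗ.[ℂ] H} (hT : IsSelfAdjoint T) {p q : H × H}
    (hp : p ∈ T.graph) (hq : q ∈ T.graph) : ⟪p.2, q.1⟫_ℂ = ⟪p.1, q.2⟫_ℂ := by
  rw [← hT.graph_adjoint, Submodule.mem_adjoint_iff] at hq
  exact sub_eq_zero.1 (hq p.1 p.2 hp)

/-- The bound `r ‖x‖ ≤ ‖(T - c) x‖`, known on a subspace of finite codimension of the domain, holds on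
the orthogonal complement of the eigenspaces with eigenvalues in `(c - r, c + r)`. -/
theorem IsSelfAdjoint.le_norm_sub_of_orthogonal_eigenspaces [FiniteDimensional ℂ V]
    {T : H →ₗ.[ℂ] H} (hT : IsSelfAdjoint T) {c r : ℝ} (hr : 0 < r) (Φ : T.graph →ₗ[ℂ] V)
    (hΦ : ∀ p : T.graph, Φ p = 0 → r * ‖p.1.1‖ ≤ ‖p.1.2 - (c : ℂ) • p.1.1‖) (N : Submodule ℂ H)
    (hN : ∀ μ : ℝ, |μ - c| < r → T.eigenspaceAt μ ≤ N)
    {p : H × H} (hp : p ∈ T.graph) (hpN : p.1 ∈ Nᗮ) : r * ‖p.1‖ ≤ ‖p.2 - (c : ℂ) • p.1‖ := by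
  -- the graph of `T - c`
  set S : (H × H) →ₗ[ℂ] (H × H) := LinearMap.prod (LinearMap.fst ℂ H H)
    (LinearMap.snd ℂ H H + (c : ℂ) • LinearMap.fst ℂ H H) with hS
  have hSa : ∀ q : H × H, S q = (q.1, q.2 + (c : ℂ) • q.1) := fun q => rfl
  set Γ : Submodule ℂ (H × H) := T.graph.comap S with hΓ
  have hΓmem : ∀ q : H × H, q ∈ Γ ↔ (q.1, q.2 + (c : ℂ) • q.1) ∈ T.graph := fun q => Iff.rfl
  have hmem' : ∀ q ∈ T.graph, (q.1, q.2 - (c : ℂ) • q.1) ∈ Γ := fun q hq => by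
    rw [hΓmem]; simpa using hq
  have hadj : Γ.adjoint = Γ := by
    ext q
    rw [hΓmem, ← hT.graph_adjoint, Submodule.mem_adjoint_iff, Submodule.mem_adjoint_iff]
    constructor
    · intro h a b hab
      have := h a _ (hmem' _ hab)
      simp only [inner_sub_left, inner_smul_left, Complex.conj_ofReal, inner_add_right,
        inner_smul_right] at this ⊢
      linear_combination this
    · intro h a b hab
      have : ⟪b + (c : ℂ) • a, q.1⟫_ℂ - ⟪a, q.2 + (c : ℂ) • q.1⟫_ℂ = 0 := h a _ hab
      simp only [inner_add_left, inner_smul_left, Complex.conj_ofReal, inner_add_right,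
        inner_smul_right] at this ⊢
      linear_combination this
  have hSΓ : ∀ q ∈ Γ, S q ∈ T.graph := fun q hq => hq
  refine Γ.le_norm_snd_of_orthogonal_eigenvectors hadj (Φ ∘ₗ S.restrict hSΓ) hr ?_ _ rfl
    (hmem' p hp) ?_
  · intro q hq
    have := hΦ _ hq
    simpa [hSa] using this
  · refine Submodule.orthogonal_le ?_ hpN
    rw [Submodule.span_le]
    rintro x ⟨μ, hμ, hx⟩
    refine hN (μ + c) (by simpa using hμ) ?_
    rw [LinearPMap.mem_eigenspaceAt_iff_graph]
    have := (hΓmem _).1 hx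
    rwa [← add_smul, ← Complex.ofReal_add] at this

section Family

variable {T : H →ₗ.[ℂ] H} {μ : ι → ℝ}

theorem IsSelfAdjoint.orthogonalFamily_eigenspaceAt (hT : IsSelfAdjoint T)
    (hμ : Function.Injective μ) :
    OrthogonalFamily ℂ (fun i => T.eigenspaceAt (μ i : ℂ))
      fun i => (T.eigenspaceAt (μ i : ℂ)).subtypeₗᵢ := by
  intro i j hij x y
  have h := hT.inner_graph x.2 y.2
  change ⟪(μ i : ℂ) • (x : H), (y : H)⟫_ℂ = ⟪(x : H), (μ j : ℂ) • (y : H)⟫_ℂ at h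
  rw [inner_smul_left, inner_smul_right, Complex.conj_ofReal, ← sub_eq_zero, ← sub_mul] at h
  refine (mul_eq_zero.1 h).resolve_left ?_
  exact fun h => hij (hμ (Complex.ofReal_injective (sub_eq_zero.1 h)))

theorem IsSelfAdjoint.norm_sumEigenvectors_lt (hT : IsSelfAdjoint T) (hμ : Function.Injective μ)
    {c r : ℝ} (hμr : ∀ i, |μ i - c| < r) (F : Finset ι)
    (x : (i : F) → T.eigenspaceAt (μ i : ℂ)) (hx : x ≠ 0) :
    ‖(T.sumEigenvectors μ F x).1.2 - (c : ℂ) • (T.sumEigenvectors μ F x).1.1‖ <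
      r * ‖(T.sumEigenvectors μ F x).1.1‖ := by
  obtain ⟨i₀, hi₀⟩ := Function.ne_iff.1 hx
  have hr : 0 < r := (abs_nonneg _).trans_lt (hμr i₀)
  have hort := hT.orthogonalFamily_eigenspaceAt (μ := fun i : F => μ i)
    (hμ.comp Subtype.val_injective)
  have h1 := hort.norm_sum x Finset.univ
  have h2 := hort.norm_sum (fun i => (((μ i - c : ℝ) : ℂ)) • x i) Finset.univ
  have e1 : (T.sumEigenvectors μ F x).1.2 - (c : ℂ) • (T.sumEigenvectors μ F x).1.1 =
      ∑ i : F, (((μ i - c : ℝ) : ℂ)) • (x i : H) := by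
    rw [LinearPMap.sumEigenvectors_fst, LinearPMap.sumEigenvectors_snd, Finset.smul_sum,
      ← Finset.sum_sub_distrib]
    refine Finset.sum_congr rfl fun i _ => ?_
    rw [← sub_smul, Complex.ofReal_sub]
  rw [e1, LinearPMap.sumEigenvectors_fst]
  refine lt_of_pow_lt_pow_left₀ 2 (by positivity) ?_
  rw [mul_pow]
  have h2' : ‖∑ i : F, (((μ i - c : ℝ) : ℂ)) • (x i : H)‖ ^ 2 =
      ∑ i : F, ‖(((μ i - c : ℝ) : ℂ)) • x i‖ ^ 2 := h2
  have h1' : ‖∑ i : F, (x i : H)‖ ^ 2 = ∑ i : F, ‖x i‖ ^ 2 := h1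
  rw [h1', h2', Finset.mul_sum]
  have hlt : ∀ i : F, (μ i - c) ^ 2 < r ^ 2 := fun i => sq_lt_sq' (by linarith [abs_lt.1 (hμr i)])
    (abs_lt.1 (hμr i)).2
  refine Finset.sum_lt_sum (fun i _ => ?_) ⟨i₀, Finset.mem_univ _, ?_⟩
  · rw [norm_smul, mul_pow, Complex.norm_real, Real.norm_eq_abs, sq_abs]
    exact mul_le_mul_of_nonneg_right (hlt i).le (by positivity)
  · rw [norm_smul, mul_pow, Complex.norm_real, Real.norm_eq_abs, sq_abs]
    have : 0 < ‖x i₀‖ := norm_pos_iff.2 hi₀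
    exact mul_lt_mul_of_pos_right (hlt i₀) (by positivity)

theorem IsSelfAdjoint.injective_comp_sumEigenvectors (hT : IsSelfAdjoint T)
    (hμ : Function.Injective μ) {c r : ℝ} (hμr : ∀ i, |μ i - c| < r) (Φ : T.graph →ₗ[ℂ] V)
    (hΦ : ∀ p : T.graph, Φ p = 0 → r * ‖p.1.1‖ ≤ ‖p.1.2 - (c : ℂ) • p.1.1‖) (F : Finset ι) :
    Function.Injective (Φ ∘ₗ T.sumEigenvectors μ F) := by
  rw [injective_iff_map_eq_zero]
  intro x hx
  by_contra hne
  exact (hΦ _ hx).not_gt (hT.norm_sumEigenvectors_lt hμ hμr F x hne)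

theorem IsSelfAdjoint.finiteDimensional_eigenspaceAt [FiniteDimensional ℂ V]
    (hT : IsSelfAdjoint T) {c r : ℝ}
    (Φ : T.graph →ₗ[ℂ] V)
    (hΦ : ∀ p : T.graph, Φ p = 0 → r * ‖p.1.1‖ ≤ ‖p.1.2 - (c : ℂ) • p.1.1‖) {t : ℝ}
    (ht : |t - c| < r) : FiniteDimensional ℂ (T.eigenspaceAt (t : ℂ)) := by
  have h := hT.injective_comp_sumEigenvectors (ι := Unit) (μ := fun _ => t)
    (fun _ _ _ => rfl) (fun _ => ht) Φ hΦ Finset.univ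
  have h2 := FiniteDimensional.of_injective _ h
  refine FiniteDimensional.of_injective
    (LinearMap.pi fun _ : (Finset.univ : Finset Unit) =>
      (LinearMap.id : T.eigenspaceAt (t : ℂ) →ₗ[ℂ] _)) fun x y hxy => ?_
  exact congrFun hxy ⟨(), Finset.mem_univ _⟩

/-- If `r ‖x‖ ≤ ‖(T - c) x‖` on the kernel of `Φ`, then `Φ` is injective on the sums of eigenvectors
with eigenvalues at distance less than `r` from `c`, so their number is at most the rank of `Φ`. -/
theorem IsSelfAdjoint.sum_finrank_eigenspaceAt_le [FiniteDimensional ℂ V]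
    (hT : IsSelfAdjoint T)
    (hμ : Function.Injective μ) {c r : ℝ} (hμr : ∀ i, |μ i - c| < r) (Φ : T.graph →ₗ[ℂ] V)
    (hΦ : ∀ p : T.graph, Φ p = 0 → r * ‖p.1.1‖ ≤ ‖p.1.2 - (c : ℂ) • p.1.1‖) (F : Finset ι) :
    ∑ i ∈ F, Module.finrank ℂ (T.eigenspaceAt (μ i : ℂ)) ≤ Module.finrank ℂ V := by
  have h := hT.injective_comp_sumEigenvectors hμ hμr Φ hΦ F
  have hfin : ∀ i : F, FiniteDimensional ℂ (T.eigenspaceAt (μ i : ℂ)) := fun i =>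
    hT.finiteDimensional_eigenspaceAt Φ hΦ (hμr i)
  have := LinearMap.finrank_le_finrank_of_injective h
  rwa [Module.finrank_pi_fintype, Finset.sum_coe_sort F
    (fun i => Module.finrank ℂ (T.eigenspaceAt (μ i : ℂ)))] at this

/-- If `‖(T - c) x‖ < r ‖x‖` on a subspace of the domain, then the dimension of this subspace is at
most the number of eigenvalues of `T` at distance less than `r` from `c`. -/
theorem IsSelfAdjoint.exists_finrank_le_sum [FiniteDimensional ℂ V]
    (hT : IsSelfAdjoint T)
    (hμ : Function.Injective μ) {c r : ℝ} (hr : 0 < r) (hμr : ∀ i, |μ i - c| < r)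
    (hsurj : ∀ t, |t - c| < r → ∃ i, μ i = t) (Φ : T.graph →ₗ[ℂ] V)
    (hΦ : ∀ p : T.graph, Φ p = 0 → r * ‖p.1.1‖ ≤ ‖p.1.2 - (c : ℂ) • p.1.1‖)
    (U : W →ₗ[ℂ] T.graph)
    (hU : ∀ w, w ≠ 0 → ‖(U w).1.2 - (c : ℂ) • (U w).1.1‖ < r * ‖(U w).1.1‖) :
    ∃ F : Finset ι, Module.finrank ℂ W ≤
      ∑ i ∈ F, Module.finrank ℂ (T.eigenspaceAt (μ i : ℂ)) := by
  have hfin : ∀ i, FiniteDimensional ℂ (T.eigenspaceAt (μ i : ℂ)) := fun i =>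
    hT.finiteDimensional_eigenspaceAt Φ hΦ (hμr i)
  have hset : {i | Module.finrank ℂ (T.eigenspaceAt (μ i : ℂ)) ≠ 0}.Finite := by
    by_contra hinf
    obtain ⟨F, hF, hcard⟩ := Set.Infinite.exists_subset_card_eq hinf (Module.finrank ℂ V + 1)
    have h1 := hT.sum_finrank_eigenspaceAt_le hμ hμr Φ hΦ F
    have h2 : ∑ i ∈ F, 1 ≤ ∑ i ∈ F, Module.finrank ℂ (T.eigenspaceAt (μ i : ℂ)) :=
      Finset.sum_le_sum fun i hi => Nat.one_le_iff_ne_zero.2 (hF hi)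
    rw [Finset.sum_const, hcard] at h2
    simp at h2
    omega
  -- all other eigenspaces are trivial
  set F := hset.toFinset with hF
  refine ⟨F, ?_⟩
  set N : Submodule ℂ H := ⨆ i : F, T.eigenspaceAt (μ i : ℂ) with hN
  have hNle : ∀ t : ℝ, |t - c| < r → T.eigenspaceAt (t : ℂ) ≤ N := by
    intro t ht
    obtain ⟨i, rfl⟩ := hsurj t ht
    by_cases hi : Module.finrank ℂ (T.eigenspaceAt (μ i : ℂ)) = 0
    · rw [Submodule.finrank_eq_zero.1 hi]; exact bot_le
    · exact le_iSup (fun i : F => T.eigenspaceAt (μ i : ℂ)) ⟨i, by simpa [hF] using hi⟩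
  have hNfin : FiniteDimensional ℂ N := Submodule.finiteDimensional_iSup _
  have hNrank : Module.finrank ℂ N ≤ ∑ i ∈ F, Module.finrank ℂ (T.eigenspaceAt (μ i : ℂ)) := by
    rw [← Finset.sum_coe_sort F (fun i => Module.finrank ℂ (T.eigenspaceAt (μ i : ℂ))),
      ← Module.finrank_pi_fintype]
    set L : ((i : F) → T.eigenspaceAt (μ i : ℂ)) →ₗ[ℂ] H :=
      (LinearMap.fst ℂ H H) ∘ₗ T.graph.subtype ∘ₗ T.sumEigenvectors μ F with hL
    have hle : N ≤ LinearMap.range L := by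
      refine iSup_le fun i x hx => ?_
      classical
      refine ⟨Pi.single i ⟨x, hx⟩, ?_⟩
      change (T.sumEigenvectors μ F _).1.1 = x
      rw [LinearPMap.sumEigenvectors_fst, Finset.sum_eq_single i]
      · simp
      · intro j _ hj
        simp [Pi.single_eq_of_ne hj]
      · simp
    exact (Submodule.finrank_mono hle).trans (LinearMap.finrank_range_le L)
  refine le_trans ?_ hNrank
  -- a vector `U w` orthogonal to all eigenvectors would satisfy the opposite inequality
  have hinj : Function.Injective (N.orthogonalProjectionOnto.toLinearMap ∘ₗ
      (LinearMap.fst ℂ H H) ∘ₗ T.graph.subtype ∘ₗ U) := by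
    rw [injective_iff_map_eq_zero]
    intro w hw
    by_contra hne
    have h1 : (U w).1.1 ∈ Nᗮ := by
      rw [← Submodule.orthogonalProjectionOnto_eq_zero_iff]
      exact hw
    exact (hT.le_norm_sub_of_orthogonal_eigenspaces hr Φ hΦ N hNle (U w).2 h1).not_gt (hU w hne)
  exact LinearMap.finrank_le_finrank_of_injective hinj

end Family

theorem abs_units_mul_sub_lt_iff (s : ℤˣ) (lam t : ℝ) :
    |((s : ℤ) : ℝ) * t - ((s : ℤ) : ℝ) * (lam / 2)| < lam / 2 ↔ t ∈ Ioo 0 lam := by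
  rw [← mul_sub, abs_mul]
  rcases Int.units_eq_one_or s with rfl | rfl <;>
  · simp only [Units.val_one, Int.cast_one, abs_one, one_mul, Units.val_neg, Int.cast_neg, abs_neg,
      abs_lt, mem_Ioo]
    constructor <;> rintro ⟨h1, h2⟩ <;> constructor <;> linarith

/-- The eigenvalues `s t` with `0 < t < lam` are those at distance less than `lam / 2` from
`s lam / 2`. Their number lies between the dimension of a space of test vectors and the codimension
of a space on which `T` is far from `s lam / 2`. -/
theorem IsSelfAdjoint.countEigenvalues_bounds [FiniteDimensional ℂ V]
    {T : H →ₗ.[ℂ] H} (hT : IsSelfAdjoint T) (s : ℤˣ)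
    {lam : ℝ} (hlam : 0 < lam) (Φ : T.graph →ₗ[ℂ] V)
    (hΦ : ∀ p : T.graph, Φ p = 0 →
      lam / 2 * ‖p.1.1‖ ≤ ‖p.1.2 - ((((s : ℤ) : ℝ) * (lam / 2) : ℝ) : ℂ) • p.1.1‖)
    (U : W →ₗ[ℂ] T.graph)
    (hU : ∀ w, w ≠ 0 →
      ‖(U w).1.2 - ((((s : ℤ) : ℝ) * (lam / 2) : ℝ) : ℂ) • (U w).1.1‖ < lam / 2 * ‖(U w).1.1‖) :
    (Module.finrank ℂ W : ENNReal) ≤ T.countEigenvalues s lam ∧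
      T.countEigenvalues s lam ≤ Module.finrank ℂ V := by
  set μ : Ioo (0 : ℝ) lam → ℝ := fun t => ((s : ℤ) : ℝ) * t with hμdef
  have hs : ((s : ℤ) : ℝ) ≠ 0 := by exact_mod_cast s.ne_zero
  have hμ : Function.Injective μ := fun a b hab => Subtype.ext (mul_left_cancel₀ hs hab)
  have hμr : ∀ i, |μ i - ((s : ℤ) : ℝ) * (lam / 2)| < lam / 2 := fun i =>
    (abs_units_mul_sub_lt_iff s lam i).2 i.2
  have hsurj : ∀ t, |t - ((s : ℤ) : ℝ) * (lam / 2)| < lam / 2 → ∃ i, μ i = t := by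
    intro t ht
    have h2 : ((s : ℤ) : ℝ) * (((s : ℤ) : ℝ) * t) = t := by
      rw [← mul_assoc]
      rcases Int.units_eq_one_or s with rfl | rfl <;> simp
    refine ⟨⟨((s : ℤ) : ℝ) * t, ?_⟩, h2⟩
    rw [← abs_units_mul_sub_lt_iff s, h2]
    exact ht
  have hcount : T.countEigenvalues s lam =
      ∑' i, (Module.finrank ℂ (T.eigenspaceAt (μ i : ℂ)) : ENNReal) := by
    refine tsum_congr fun i => ?_
    have := hT.finiteDimensional_eigenspaceAt Φ hΦ (hμr i)
    have hμc : ((s : ℤ) : ℂ) * ((i : ℝ) : ℂ) = (μ i : ℂ) := by simp [hμdef]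
    rw [hμc, ← Module.finrank_eq_rank, map_natCast]
    rfl
  rw [hcount]
  constructor
  · obtain ⟨F, hF⟩ := hT.exists_finrank_le_sum hμ (by positivity) hμr hsurj Φ hΦ U hU
    refine le_trans ?_ (ENNReal.sum_le_tsum F)
    exact_mod_cast hF
  · rw [ENNReal.tsum_eq_iSup_sum]
    refine iSup_le fun F => ?_
    exact_mod_cast hT.sum_finrank_eigenspaceAt_le hμ hμr Φ hΦ F

end Counting

/-! ### Absolutely continuous functions on an edge -/

section AbsolutelyContinuous

theorem LipschitzWith.comp_absolutelyContinuousOnInterval {X Y : Type*} [PseudoMetricSpace X]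
    [PseudoMetricSpace Y] {φ : X → Y} (hφ : LipschitzWith 1 φ) {f : ℝ → X} {x y : ℝ}
    (hf : AbsolutelyContinuousOnInterval f x y) :
    AbsolutelyContinuousOnInterval (fun t => φ (f t)) x y := by
  rw [absolutelyContinuousOnInterval_iff] at hf ⊢
  intro ε hε
  obtain ⟨δ, hδ, h⟩ := hf ε hε
  refine ⟨δ, hδ, fun E hE hlt => lt_of_le_of_lt (Finset.sum_le_sum fun i _ => ?_) (h E hE hlt)⟩
  simpa using hφ.dist_le_mul (f (E.2 i).1) (f (E.2 i).2)

theorem lipschitzWith_re : LipschitzWith 1 Complex.re :=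
  LipschitzWith.of_dist_le_mul fun x y => by
    simpa [Real.dist_eq, Complex.dist_eq] using Complex.abs_re_le_norm (x - y)

theorem lipschitzWith_im : LipschitzWith 1 Complex.im :=
  LipschitzWith.of_dist_le_mul fun x y => by
    simpa [Real.dist_eq, Complex.dist_eq] using Complex.abs_im_le_norm (x - y)

theorem AbsolutelyContinuousOnInterval.integral_eq_sub_of_ae_hasDerivAt {f f' : ℝ → ℝ} {x y : ℝ}
    (hxy : x ≤ y) (hf : AbsolutelyContinuousOnInterval f x y)
    (hd : ∀ᵐ t ∂volume.restrict (Ioo x y), HasDerivAt f (f' t) t) :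
    IntervalIntegrable f' volume x y ∧ ∫ t in x..y, f' t = f y - f x := by
  have hae : deriv f =ᵐ[volume.restrict (uIoc x y)] f' := by
    rw [uIoc_of_le hxy, ← restrict_Ioo_eq_restrict_Ioc]
    filter_upwards [hd] with t ht using ht.deriv
  refine ⟨hf.intervalIntegrable_deriv.congr_ae hae, ?_⟩
  rw [← hf.integral_deriv_eq_sub]
  exact intervalIntegral.integral_congr_ae_restrict hae.symm

theorem AbsolutelyContinuousOnInterval.integral_eq_sub_of_ae_hasDerivAt_complex {f f' : ℝ → ℂ}
    {x y : ℝ} (hxy : x ≤ y) (hf : AbsolutelyContinuousOnInterval f x y)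
    (hd : ∀ᵐ t ∂volume.restrict (Ioo x y), HasDerivAt f (f' t) t)
    (hi : IntervalIntegrable f' volume x y) : ∫ t in x..y, f' t = f y - f x := by
  have hre := (lipschitzWith_re.comp_absolutelyContinuousOnInterval
    hf).integral_eq_sub_of_ae_hasDerivAt (f' := fun t => (f' t).re) hxy (by
      filter_upwards [hd] with t ht using (Complex.reCLM.hasFDerivAt.comp_hasDerivAt t ht))
  have him := (lipschitzWith_im.comp_absolutelyContinuousOnInterval
    hf).integral_eq_sub_of_ae_hasDerivAt (f' := fun t => (f' t).im) hxy (by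
      filter_upwards [hd] with t ht using (Complex.imCLM.hasFDerivAt.comp_hasDerivAt t ht))
  refine Complex.ext ?_ ?_
  · rw [Complex.sub_re, ← hre.2]
    exact (Complex.reCLM.intervalIntegral_comp_comm hi).symm
  · rw [Complex.sub_im, ← him.2]
    exact (Complex.imCLM.intervalIntegral_comp_comm hi).symm

end AbsolutelyContinuous

namespace IsH2Rep

variable {s : Set ℝ} {ψ w : Lp ℂ 2 (volume.restrict s)} {u v : ℝ → ℂ}

theorem continuousOn (h : IsH2Rep s ψ u v w) : ContinuousOn u s :=
  fun x hx => (h.deriv x hx).continuousWithinAt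

theorem continuousOn_deriv (h : IsH2Rep s ψ u v w) {x y : ℝ} (hx : x ∈ s) (hy : y ∈ s) :
    ContinuousOn v (uIcc x y) :=
  (h.ac_deriv x hx y hy).continuousOn

theorem hasDerivAt (h : IsH2Rep s ψ u v w) {x y t : ℝ} (hs : Icc x y ⊆ s) (ht : t ∈ Ioo x y) :
    HasDerivAt u (v t) t :=
  (h.deriv t (hs (Ioo_subset_Icc_self ht))).hasDerivAt
    (mem_of_superset (Icc_mem_nhds ht.1 ht.2) hs)

theorem ae_hasDerivAt_deriv (h : IsH2Rep s ψ u v w) {x y : ℝ} (hs : Icc x y ⊆ s) :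
    ∀ᵐ t ∂volume.restrict (Ioo x y), HasDerivAt v (w t) t := by
  have h1 := ae_restrict_of_ae_restrict_of_subset (Ioo_subset_Icc_self.trans hs) h.deriv_deriv
  filter_upwards [h1, ae_restrict_mem measurableSet_Ioo] with t ht htm
  exact ht.hasDerivAt (mem_of_superset (Icc_mem_nhds htm.1 htm.2) hs)

/-- Integration by parts, `∫ Re (ū u'') ≤ Re (ū u')` between the end points, the dropped term being
`∫ |u'|²`. The real parts are written out in coordinates. -/
theorem integral_le (h : IsH2Rep s ψ u v w) {x y : ℝ} (hxy : x ≤ y) (hs : Icc x y ⊆ s) :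
    ∫ t in x..y, ((w t).re * (u t).re + (w t).im * (u t).im) ≤
      ((v y).re * (u y).re + (v y).im * (u y).im) -
        ((v x).re * (u x).re + (v x).im * (u x).im) := by
  have hx : x ∈ s := hs (left_mem_Icc.2 hxy)
  have hy : y ∈ s := hs (right_mem_Icc.2 hxy)
  have hu := h.ac x hx y hy
  have hv := h.ac_deriv x hx y hy
  have hF := ((lipschitzWith_re.comp_absolutelyContinuousOnInterval hv).mul
    (lipschitzWith_re.comp_absolutelyContinuousOnInterval hu)).add
    ((lipschitzWith_im.comp_absolutelyContinuousOnInterval hv).mul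
    (lipschitzWith_im.comp_absolutelyContinuousOnInterval hu))
  have hF' := hF.integral_eq_sub_of_ae_hasDerivAt (f' := fun t =>
      (((w t).re * (u t).re + (v t).re * (v t).re) +
        ((w t).im * (u t).im + (v t).im * (v t).im))) hxy (by
    filter_upwards [h.ae_hasDerivAt_deriv hs, ae_restrict_mem measurableSet_Ioo] with t ht htm
    have hut := h.hasDerivAt hs htm
    exact ((Complex.reCLM.hasFDerivAt.comp_hasDerivAt t ht).mul
      (Complex.reCLM.hasFDerivAt.comp_hasDerivAt t hut)).add
      ((Complex.imCLM.hasFDerivAt.comp_hasDerivAt t ht).mul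
      (Complex.imCLM.hasFDerivAt.comp_hasDerivAt t hut)))
  have hvc := h.continuousOn_deriv hx hy
  have hsq : IntervalIntegrable (fun t => (v t).re * (v t).re + (v t).im * (v t).im)
      volume x y := by
    refine ContinuousOn.intervalIntegrable ?_
    have h1 := Complex.continuous_re.comp_continuousOn hvc
    have h2 := Complex.continuous_im.comp_continuousOn hvc
    exact (h1.mul h1).add (h2.mul h2)
  refine le_trans ?_ hF'.2.le
  refine intervalIntegral.integral_mono_on hxy ?_ hF'.1 fun t _ => ?_
  · refine (hF'.1.sub hsq).congr fun t _ => ?_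
    ring
  · nlinarith [mul_self_nonneg (v t).re, mul_self_nonneg (v t).im]

theorem re_inner_eq (h : IsH2Rep s ψ u v w) :
    (⟪ψ, w⟫_ℂ).re = ∫ t in s, ((w t).re * (u t).re + (w t).im * (u t).im) := by
  rw [L2.inner_def]
  have h1 := Complex.reCLM.integral_comp_comm (L2.integrable_inner (𝕜 := ℂ) ψ w)
  change (∫ t in s, ⟪ψ t, w t⟫_ℂ : ℂ).re = _
  rw [← Complex.reCLM_apply, ← h1]
  refine integral_congr_ae ?_
  filter_upwards [h.ae_eq] with t ht
  rw [ht]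
  simp [RCLike.inner_apply]

theorem integrable_re_inner (h : IsH2Rep s ψ u v w) :
    Integrable (fun t => (w t).re * (u t).re + (w t).im * (u t).im) (volume.restrict s) := by
  refine (Complex.reCLM.integrable_comp (L2.integrable_inner (𝕜 := ℂ) ψ w)).congr ?_
  filter_upwards [h.ae_eq] with t ht
  simp [RCLike.inner_apply, ht]

theorem re_inner_nonpos_of_Icc {a : ℝ} (ha : 0 ≤ a) {ψ w : Lp ℂ 2 (volume.restrict (Icc 0 a))}
    (h : IsH2Rep (Icc 0 a) ψ u v w) (h0 : u 0 = 0) (h1 : u a = 0) : (⟪ψ, w⟫_ℂ).re ≤ 0 := by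
  rw [h.re_inner_eq, integral_Icc_eq_integral_Ioc, ← intervalIntegral.integral_of_le ha]
  refine (h.integral_le ha subset_rfl).trans ?_
  simp [h0, h1]

/-- On a half line, a positive value of `Re ⟪ψ, ψ''⟫` would force `|u|²`, whose derivative is
`2 Re (ū u')`, to grow at least linearly. -/
theorem re_inner_nonpos_of_Ici {ψ w : Lp ℂ 2 (volume.restrict (Ici (0 : ℝ)))}
    (h : IsH2Rep (Ici 0) ψ u v w) (h0 : u 0 = 0) : (⟪ψ, w⟫_ℂ).re ≤ 0 := by
  by_contra! hpos
  set l := (⟪ψ, w⟫_ℂ).re with hl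
  have hsub : ∀ y : ℝ, Icc 0 y ⊆ Ici (0 : ℝ) := fun y => Icc_subset_Ici_self
  have hlim : Tendsto (fun R : ℝ => ∫ t in (0:ℝ)..R, ((w t).re * (u t).re + (w t).im * (u t).im))
      atTop (𝓝 l) := by
    rw [hl, h.re_inner_eq, integral_Ici_eq_integral_Ioi]
    exact intervalIntegral_tendsto_integral_Ioi 0
      (h.integrable_re_inner.mono_measure (Measure.restrict_mono Ioi_subset_Ici_self le_rfl))
      tendsto_id
  obtain ⟨R, hR⟩ := eventually_atTop.1
    ((hlim.eventually (lt_mem_nhds (half_lt_self hpos))).and (eventually_ge_atTop 0))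
  have hR0 : 0 ≤ R := (hR R le_rfl).2
  set F : ℝ → ℝ := fun t => (v t).re * (u t).re + (v t).im * (u t).im with hF
  have hFge : ∀ y, R ≤ y → l / 2 ≤ F y := by
    intro y hy
    have h1 := h.integral_le (hR0.trans hy) (hsub y)
    have h2 := (hR y hy).1
    simp only [h0, Complex.zero_re, Complex.zero_im, mul_zero, add_zero, sub_zero] at h1
    exact (h2.trans_le h1).le
  set N : ℝ → ℝ := fun t => (u t).re * (u t).re + (u t).im * (u t).im with hN
  have hNd : ∀ t, 0 < t → HasDerivAt N (2 * F t) t := by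
    intro t ht
    have hut := h.hasDerivAt (hsub (t + 1)) (t := t) ⟨ht, by linarith⟩
    have hre := Complex.reCLM.hasFDerivAt.comp_hasDerivAt t hut
    have him := Complex.imCLM.hasFDerivAt.comp_hasDerivAt t hut
    refine ((hre.mul hre).add (him.mul him)).congr_deriv ?_
    simp only [Complex.reCLM_apply, Complex.imCLM_apply, hF, Function.comp_apply]
    ring
  have hNc : ContinuousOn N (Ici 0) := by
    have h1 := Complex.continuous_re.comp_continuousOn h.continuousOn
    have h2 := Complex.continuous_im.comp_continuousOn h.continuousOn
    exact (h1.mul h1).add (h2.mul h2)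
  have hmono : MonotoneOn (fun t => N t - l * t) (Ici R) := by
    refine monotoneOn_of_deriv_nonneg (convex_Ici R)
      ((hNc.mono (Ici_subset_Ici.2 hR0)).sub (by fun_prop)) ?_ ?_
    all_goals
      intro t ht
      rw [interior_Ici, mem_Ioi] at ht
      have hd := (hNd t (hR0.trans_lt ht)).sub ((hasDerivAt_id t).const_mul l)
    · exact hd.differentiableAt.differentiableWithinAt
    · have := hd.deriv
      simp only [id, Pi.sub_def] at this
      rw [this]
      have := hFge t ht.le
      linarith
  have hNge : ∀ t, R + 1 ≤ t → l ≤ N t := by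
    intro t ht
    have h1 := hmono (mem_Ici.2 le_rfl) (mem_Ici.2 (by linarith : R ≤ t)) (by linarith)
    have h2 : 0 ≤ N R := by simp only [hN]; nlinarith [mul_self_nonneg (u R).re, mul_self_nonneg (u R).im]
    simp only at h1
    nlinarith
  have hNi : IntegrableOn N (Ici (R + 1)) := by
    have h1 : Integrable N (volume.restrict (Ici 0)) := by
      refine (Complex.reCLM.integrable_comp (L2.integrable_inner (𝕜 := ℂ) ψ ψ)).congr ?_
      filter_upwards [h.ae_eq] with t ht
      rw [Complex.reCLM_apply, inner_self_eq_norm_sq_to_K, ht]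
      change (((‖u t‖ : ℝ) : ℂ) ^ 2).re = N t
      rw [← Complex.ofReal_pow, Complex.ofReal_re, Complex.sq_norm, Complex.normSq_apply]
    exact h1.mono_measure (Measure.restrict_mono (Ici_subset_Ici.2 (by linarith)) le_rfl)
  have hconst : IntegrableOn (fun _ : ℝ => l) (Ici (R + 1)) := by
    refine Integrable.mono' hNi (by fun_prop) ?_
    filter_upwards [ae_restrict_mem measurableSet_Ici] with t ht
    rw [Real.norm_of_nonneg hpos.le]
    exact hNge t ht
  rw [integrableOn_const_iff] at hconst
  simp [hpos.ne'] at hconst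

end IsH2Rep

/-! ### The periodic Fourier basis of an internal edge -/

noncomputable section

/-- The frequencies `2 π n / a` of the interval `[0, a]` with periodic boundary conditions. -/
def freq (a : ℝ) (n : ℤ) : ℝ := 2 * Real.pi * n / a

/-- The normalized exponential function with frequency `freq a n` on `[0, a]`. -/
def expFun (a : ℝ) (n : ℤ) (x : ℝ) : ℂ :=
  ((Real.sqrt a)⁻¹ : ℝ) * Complex.exp (freq a n * x * Complex.I)

theorem contDiff_expFun (a : ℝ) (n : ℤ) : ContDiff ℝ 1 (expFun a n) := by
  unfold expFun
  have : ContDiff ℝ 1 (fun x : ℝ => (x : ℂ)) := Complex.ofRealCLM.contDiff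
  fun_prop

theorem hasDerivAt_expFun (a : ℝ) (n : ℤ) (x : ℝ) :
    HasDerivAt (expFun a n) ((freq a n * Complex.I) * expFun a n x) x := by
  have h1 : HasDerivAt (fun x : ℝ => (freq a n * x * Complex.I : ℂ)) (freq a n * Complex.I) x := by
    have := ((hasDerivAt_id x).ofReal_comp.const_mul (freq a n : ℂ)).mul_const Complex.I
    simpa using this
  refine (h1.cexp.const_mul _).congr_deriv ?_
  rw [expFun]; ring

theorem norm_expFun (a : ℝ) (n : ℤ) (x : ℝ) : ‖expFun a n x‖ = (Real.sqrt a)⁻¹ := by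
  rw [expFun, norm_mul, Complex.norm_real, Real.norm_of_nonneg (by positivity),
    show (freq a n * x * Complex.I : ℂ) = ((freq a n * x : ℝ) : ℂ) * Complex.I by push_cast; ring,
    Complex.norm_exp_ofReal_mul_I, mul_one]

theorem expFun_zero_eq {a : ℝ} (ha : a ≠ 0) (n : ℤ) : expFun a n a = expFun a n 0 := by
  have h : (freq a n * a * Complex.I : ℂ) = n * (2 * Real.pi * Complex.I) := by
    have : (a : ℂ) ≠ 0 := by exact_mod_cast ha
    rw [freq]; push_cast; field_simp
  rw [expFun, expFun, h, Complex.exp_int_mul_two_pi_mul_I]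
  simp

theorem memLp_expFun (a : ℝ) (n : ℤ) : MemLp (expFun a n) 2 (volume.restrict (Icc 0 a)) :=
  MemLp.of_bound (contDiff_expFun a n).continuous.aestronglyMeasurable _
    (ae_of_all _ fun x => (norm_expFun a n x).le)

/-- The normalized exponential function as an element of `L²`. -/
def expLp (a : ℝ) (n : ℤ) : Lp ℂ 2 (volume.restrict (Icc 0 a)) := (memLp_expFun a n).toLp

theorem coeFn_expLp (a : ℝ) (n : ℤ) : expLp a n =ᵐ[volume.restrict (Icc 0 a)] expFun a n :=
  MemLp.coeFn_toLp _

theorem inner_expLp {a : ℝ} (ha : 0 < a) (n : ℤ) (ψ : Lp ℂ 2 (volume.restrict (Icc 0 a))) :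
    ⟪expLp a n, ψ⟫_ℂ = ∫ x in (0 : ℝ)..a, expFun a (-n) x * ψ x := by
  rw [L2.inner_def, intervalIntegral.integral_of_le ha.le, ← integral_Icc_eq_integral_Ioc]
  refine integral_congr_ae ?_
  filter_upwards [coeFn_expLp a n] with x hx
  rw [hx, RCLike.inner_apply, mul_comm]
  congr 1
  simp only [expFun, map_mul, ← Complex.exp_conj, Complex.conj_ofReal, Complex.conj_I, freq]
  push_cast
  congr 2
  ring

/-- Parseval's identity. -/
theorem hasSum_norm_sq_inner_expLp {a : ℝ} (ha : 0 < a)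
    (ψ : Lp ℂ 2 (volume.restrict (Icc 0 a))) :
    HasSum (fun n => ‖⟪expLp a n, ψ⟫_ℂ‖ ^ 2) (‖ψ‖ ^ 2) := by
  have hL : MemLp ψ 2 (volume.restrict (Ioc 0 a)) :=
    (Lp.memLp ψ).mono_measure (Measure.restrict_mono Ioc_subset_Icc_self le_rfl)
  have h1 := (hasSum_sq_fourierCoeffOn ha hL).mul_left a
  have e1 : (fun n => ‖⟪expLp a n, ψ⟫_ℂ‖ ^ 2) = fun n => a * ‖fourierCoeffOn ha ψ n‖ ^ 2 := by
    ext n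
    rw [fourierCoeffOn_eq_integral, inner_expLp ha]
    have : ∀ x : ℝ, expFun a (-n) x * ψ x = ((Real.sqrt a)⁻¹ : ℝ) *
        ((fourier (-n) (x : AddCircle (a - 0)) : ℂ) • ψ x) := by
      intro x
      rw [fourier_coe_apply, expFun, freq, smul_eq_mul, mul_assoc]
      congr 3
      push_cast
      rw [sub_zero]
      ring
    simp_rw [this]
    rw [intervalIntegral.integral_const_mul, norm_mul, norm_smul, mul_pow, mul_pow,
      Complex.norm_real, Real.norm_of_nonneg (by positivity), Real.norm_of_nonneg (by
        rw [sub_zero]; positivity), sub_zero, inv_pow, Real.sq_sqrt ha.le]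
    field_simp
  have e2 : ‖ψ‖ ^ 2 = a * (a - 0)⁻¹ • ∫ x in (0 : ℝ)..a, ‖ψ x‖ ^ 2 := by
    rw [smul_eq_mul, sub_zero, mul_inv_cancel_left₀ ha.ne', intervalIntegral.integral_of_le ha.le,
      ← integral_Icc_eq_integral_Ioc]
    have h2 := L2.inner_def (𝕜 := ℂ) ψ ψ
    rw [inner_self_eq_norm_sq_to_K] at h2
    apply Complex.ofReal_injective
    rw [← integral_complex_ofReal]
    push_cast
    refine h2.trans (integral_congr_ae (ae_of_all _ fun x => ?_))
    simp only [inner_self_eq_norm_sq_to_K]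
    rfl
  rw [e1, e2]
  exact h1

theorem orthonormal_expLp {a : ℝ} (ha : 0 < a) : Orthonormal ℂ (expLp a) := by
  have hnorm : ∀ n, ‖expLp a n‖ = 1 := by
    intro n
    have h : ‖expLp a n‖ ^ 2 = 1 := by
      have h2 := L2.inner_def (𝕜 := ℂ) (expLp a n) (expLp a n)
      rw [inner_self_eq_norm_sq_to_K] at h2
      apply Complex.ofReal_injective
      push_cast
      refine h2.trans ?_
      have h3 : ∫ x in Icc 0 a, ⟪expLp a n x, expLp a n x⟫_ℂ = ∫ x in Icc 0 a, ((a⁻¹ : ℝ) : ℂ) := by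
        refine integral_congr_ae ?_
        filter_upwards [coeFn_expLp a n] with x hx
        rw [hx, inner_self_eq_norm_sq_to_K, norm_expFun]
        norm_cast
        rw [inv_pow, Real.sq_sqrt ha.le]
        rfl
      rw [h3, setIntegral_const]
      simp [ha.le, ha.ne']
    nlinarith [norm_nonneg (expLp a n)]
  refine ⟨hnorm, fun m n hmn => ?_⟩
  -- in Parseval's identity for `expLp a n`, the term with index `n` is already the whole sum
  have h := sum_le_hasSum {m, n} (fun _ _ => by positivity) (hasSum_norm_sq_inner_expLp ha (expLp a n))
  rw [Finset.sum_pair hmn, inner_self_eq_norm_sq_to_K, hnorm] at h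
  have h2 : ‖⟪expLp a m, expLp a n⟫_ℂ‖ ^ 2 ≤ 0 := by simpa using h
  have h3 := sq_eq_zero_iff.1 (le_antisymm h2 (by positivity))
  exact norm_eq_zero.1 h3

theorem isH2Rep_expLp (a : ℝ) (n : ℤ) :
    IsH2Rep (Icc 0 a) (expLp a n) (expFun a n) ((freq a n * Complex.I : ℂ) • expFun a n)
      ((-(freq a n : ℂ) ^ 2) • expLp a n) := by
  refine ⟨coeFn_expLp a n, ?_, ?_, ?_, ?_⟩
  · intro x _ y _
    exact (contDiff_expFun a n).contDiffOn.absolutelyContinuousOnInterval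
  · intro x _
    exact (hasDerivAt_expFun a n x).hasDerivWithinAt
  · have h : LocallyAC (Icc 0 a) (expFun a n) := fun x _ y _ =>
      (contDiff_expFun a n).contDiffOn.absolutelyContinuousOnInterval
    exact h.const_smul (freq a n * Complex.I)
  · filter_upwards [Lp.coeFn_smul (-(freq a n : ℂ) ^ 2) (expLp a n), coeFn_expLp a n] with x h1 h2
    have h3 : (((-(freq a n : ℂ) ^ 2) • expLp a n : Lp ℂ 2 (volume.restrict (Icc 0 a))) : ℝ → ℂ) x
        = (freq a n * Complex.I : ℂ) • ((freq a n * Complex.I) * expFun a n x) := by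
      rw [h1, Pi.smul_apply, h2, smul_eq_mul, smul_eq_mul]
      linear_combination -(freq a n : ℂ) ^ 2 * expFun a n x * Complex.I_sq
    rw [h3]
    exact ((hasDerivAt_expFun a n x).const_smul (freq a n * Complex.I : ℂ)).hasDerivWithinAt

theorem integral_expFun_mul_deriv {a : ℝ} (ha : 0 < a) (n : ℤ) {f f' : ℝ → ℂ}
    (hf : AbsolutelyContinuousOnInterval f 0 a) (h0 : f 0 = f a)
    (hd : ∀ᵐ t ∂volume.restrict (Ioo 0 a), HasDerivAt f (f' t) t)
    (hi : IntervalIntegrable f' volume 0 a) :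
    ∫ x in (0 : ℝ)..a, expFun a n x * f' x =
      -(freq a n * Complex.I) * ∫ x in (0 : ℝ)..a, expFun a n x * f x := by
  have hg := (contDiff_expFun a n)
  have hac : AbsolutelyContinuousOnInterval (expFun a n • f) 0 a :=
    hg.contDiffOn.absolutelyContinuousOnInterval.smul hf
  have i1 : IntervalIntegrable (fun x => expFun a n x * f' x) volume 0 a :=
    hi.continuousOn_mul hg.continuous.continuousOn
  have i2 : IntervalIntegrable (fun x => (freq a n * Complex.I) * (expFun a n x * f x)) volume 0 a :=
    ((hg.continuous.continuousOn.mul hf.continuousOn).intervalIntegrable).const_mul _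
  have h := hac.integral_eq_sub_of_ae_hasDerivAt_complex
    (f' := fun x => expFun a n x * f' x + (freq a n * Complex.I) * (expFun a n x * f x)) ha.le (by
      filter_upwards [hd] with t ht
      refine ((hasDerivAt_expFun a n t).mul ht).congr_deriv ?_
      ring) (i1.add i2)
  rw [intervalIntegral.integral_add i1 i2, intervalIntegral.integral_const_mul] at h
  simp only [Pi.smul_apply', smul_eq_mul, expFun_zero_eq ha.ne', h0, sub_self] at h
  linear_combination h

theorem freq_neg (a : ℝ) (n : ℤ) : freq a (-n) = -freq a n := by
  simp [freq, neg_div]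

/-- Two integrations by parts; the boundary terms cancel for periodic boundary values. -/
theorem IsH2Rep.inner_expLp_deriv_deriv {a : ℝ} (ha : 0 < a)
    {ψ w : Lp ℂ 2 (volume.restrict (Icc 0 a))} {u v : ℝ → ℂ} (h : IsH2Rep (Icc 0 a) ψ u v w)
    (hu : u 0 = u a) (hv : v 0 = v a) (n : ℤ) :
    ⟪expLp a n, w⟫_ℂ = (-freq a n ^ 2 : ℝ) * ⟪expLp a n, ψ⟫_ℂ := by
  have h0 : (0 : ℝ) ∈ Icc 0 a := left_mem_Icc.2 ha.le
  have h1 : a ∈ Icc 0 a := right_mem_Icc.2 ha.le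
  have hw : IntervalIntegrable w volume 0 a := by
    rw [intervalIntegrable_iff_integrableOn_Icc_of_le ha.le]
    exact (Lp.memLp w).integrable one_le_two
  have e1 := integral_expFun_mul_deriv ha (-n) (h.ac_deriv 0 h0 a h1) hv
    (h.ae_hasDerivAt_deriv subset_rfl) hw
  have e2 := integral_expFun_mul_deriv ha (-n) (h.ac 0 h0 a h1) hu
    (by
      filter_upwards [ae_restrict_mem measurableSet_Ioo] with t ht
      exact h.hasDerivAt subset_rfl ht) (h.continuousOn_deriv h0 h1).intervalIntegrable
  have e3 : ∫ x in (0 : ℝ)..a, expFun a (-n) x * ψ x = ∫ x in (0 : ℝ)..a, expFun a (-n) x * u x := by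
    refine intervalIntegral.integral_congr_ae_restrict ?_
    rw [uIoc_of_le ha.le]
    filter_upwards [ae_restrict_of_ae_restrict_of_subset Ioc_subset_Icc_self h.ae_eq] with x hx
    rw [hx]
  rw [inner_expLp ha, inner_expLp ha, e3, e1, e2, freq_neg]
  push_cast
  linear_combination (freq a n : ℂ) ^ 2 * (∫ x in (0 : ℝ)..a, expFun a (-n) x * u x) *
    Complex.I_sq

end

/-! ### Quadratic bounds on the edges -/

section EdgeBounds

theorem le_norm_sub_of_re_inner_nonpos {H : Type*} [NormedAddCommGroup H] [InnerProductSpace ℂ H]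
    {x y : H} (h : (⟪x, y⟫_ℂ).re ≤ 0) {r : ℝ} (hr : 0 ≤ r) : r * ‖x‖ ≤ ‖y - (r : ℂ) • x‖ := by
  refine le_of_sq_le_sq ?_ (norm_nonneg _)
  rw [@norm_sub_sq ℂ, inner_smul_right, norm_smul, Complex.norm_real, Real.norm_of_nonneg hr]
  have h1 : (⟪y, x⟫_ℂ).re ≤ 0 := by rwa [← inner_conj_symm, Complex.conj_re]
  have h2 : RCLike.re ((r : ℂ) * ⟪y, x⟫_ℂ) = r * (⟪y, x⟫_ℂ).re := Complex.re_ofReal_mul _ _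
  rw [h2]
  nlinarith [mul_nonneg hr (neg_nonneg.2 h1), sq_nonneg ‖y‖]

/-- A function with periodic boundary values and no Fourier coefficients at the frequencies `κ` with
`κ² < 2 r` has `r ‖ψ‖ ≤ ‖ψ'' + r ψ‖`, because `|r - κ²| ≥ r` for the other frequencies. -/
theorem IsH2Rep.le_norm_add {a : ℝ} (ha : 0 < a)
    {ψ w : Lp ℂ 2 (volume.restrict (Icc 0 a))} {u v : ℝ → ℂ} (h : IsH2Rep (Icc 0 a) ψ u v w)
    (hu : u 0 = u a) (hv : v 0 = v a) {r : ℝ}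
    (hψ : ∀ n, freq a n ^ 2 < 2 * r → ⟪expLp a n, ψ⟫_ℂ = 0) :
    r * ‖ψ‖ ≤ ‖w + (r : ℂ) • ψ‖ := by
  refine le_of_sq_le_sq ?_ (norm_nonneg _)
  rw [mul_pow]
  refine hasSum_le (fun n => ?_) ((hasSum_norm_sq_inner_expLp ha ψ).mul_left (r ^ 2))
    (hasSum_norm_sq_inner_expLp ha _)
  have e : ⟪expLp a n, w + (r : ℂ) • ψ⟫_ℂ = ((r - freq a n ^ 2 : ℝ) : ℂ) * ⟪expLp a n, ψ⟫_ℂ := by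
    rw [inner_add_right, inner_smul_right, h.inner_expLp_deriv_deriv ha hu hv]
    push_cast
    ring
  rw [e, norm_mul, mul_pow, Complex.norm_real, Real.norm_eq_abs, sq_abs]
  rcases lt_or_ge (freq a n ^ 2) (2 * r) with hlt | hge
  · rw [hψ n hlt]; simp
  · have : r ^ 2 ≤ (r - freq a n ^ 2) ^ 2 := by nlinarith
    gcongr

end EdgeBounds

noncomputable section

/-! ### Vectors supported on the internal edges -/

section EdgeSum

variable {E I : Type*} (S : I → Finset ℤ) {M : E ⊕ I → Type*} [∀ j, AddCommGroup (M j)] [∀ j, Module ℂ (M j)]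

/-- The linear combinations of vectors `b i n`, `n ∈ S i`, attached to the internal edges, extended
by zero to the external edges. -/
def edgeSum (b : (i : I) → ℤ → M (Sum.inr i)) : ((i : I) → S i → ℂ) →ₗ[ℂ] ((j : E ⊕ I) → M j) :=
  LinearMap.pi fun j => match j with
    | Sum.inl _ => 0
    | Sum.inr i => ∑ n : S i, (LinearMap.toSpanSingleton ℂ _ (b i n)) ∘ₗ
        (LinearMap.proj n : (S i → ℂ) →ₗ[ℂ] ℂ) ∘ₗ LinearMap.proj i

theorem edgeSum_inr {S : I → Finset ℤ} (b : (i : I) → ℤ → M (Sum.inr i)) (α : (i : I) → S i → ℂ) (i : I) :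
    edgeSum S b α (Sum.inr i) = ∑ n : S i, α i n • b i n := by
  simp [edgeSum]

end EdgeSum

namespace SignedMetricGraph

variable {V E I : Type*} [Fintype E] [Fintype I] (G : SignedMetricGraph V E I)
  (A B : BoundarySpace E I →ₗ[ℂ] BoundarySpace E I)

/-- The boundary values can be taken to depend linearly on the elements of the graph of `T(A, B)`.
The representatives `u`, `v` are not chosen linearly: the relation between the elements of the
graph and the boundary values is a subspace, and a linear section of its projection is used. -/
theorem exists_traceMap : ∃ Tr : (G.op A B).graph →ₗ[ℂ] BoundarySpace E I × BoundarySpace E I,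
    ∀ p, ∃ (u v : E ⊕ I → ℝ → ℂ) (w : G.Hilb),
      (∀ j, IsH2Rep (G.interval j) (p.1.1 j) (u j) (v j) (w j)) ∧
      (∀ j, p.1.2 j = -(((G.sgn j : ℤ) : ℂ) • w j)) ∧
      (G.trace u, G.dtrace v) = Tr p := by
  set R : Submodule ℂ ((G.op A B).graph × (BoundarySpace E I × BoundarySpace E I)) :=
    { carrier := {q | ∃ (u v : E ⊕ I → ℝ → ℂ) (w : G.Hilb),
        (∀ j, IsH2Rep (G.interval j) (q.1.1.1 j) (u j) (v j) (w j)) ∧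
        (∀ j, q.1.1.2 j = -(((G.sgn j : ℤ) : ℂ) • w j)) ∧
        (G.trace u, G.dtrace v) = q.2}
      zero_mem' := by
        refine ⟨(0 : ℂ) • 0, (0 : ℂ) • 0, 0, fun j => ?_, fun j => by simp, ?_⟩
        · simpa using IsH2Rep.zero _
        · rw [trace_smul, dtrace_smul]; simp
      add_mem' := by
        rintro q q' ⟨u, v, w, h1, h2, h3⟩ ⟨u', v', w', h1', h2', h3'⟩
        refine ⟨u + u', v + v', w + w', fun j => (h1 j).add (h1' j), fun j => ?_, ?_⟩
        · have : (q + q').1.1.2 j = q.1.1.2 j + q'.1.1.2 j := rfl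
          rw [this, h2 j, h2' j, PiLp.add_apply, smul_add, neg_add]
        · rw [trace_add, dtrace_add, Prod.snd_add, ← h3, ← h3', Prod.mk_add_mk]
      smul_mem' := by
        rintro c q ⟨u, v, w, h1, h2, h3⟩
        refine ⟨c • u, c • v, c • w, fun j => (h1 j).smul c, fun j => ?_, ?_⟩
        · have : (c • q).1.1.2 j = c • q.1.1.2 j := rfl
          rw [this, h2 j, PiLp.smul_apply, smul_neg, smul_comm]
        · rw [trace_smul, dtrace_smul, Prod.smul_snd, ← h3, Prod.smul_mk] }
  have hsurj : LinearMap.range ((LinearMap.fst ℂ _ _) ∘ₗ R.subtype) = ⊤ := by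
    rw [LinearMap.range_eq_top]
    rintro ⟨p, hp⟩
    have hp' := hp
    rw [op_graph] at hp'
    obtain ⟨u, v, w, h1, h2, -⟩ := hp'
    exact ⟨⟨(⟨p, hp⟩, (G.trace u, G.dtrace v)), u, v, w, h1, h2, rfl⟩, rfl⟩
  obtain ⟨g, hg⟩ := LinearMap.exists_rightInverse_of_surjective _ hsurj
  refine ⟨(LinearMap.snd ℂ _ _) ∘ₗ R.subtype ∘ₗ g, fun p => ?_⟩
  have hgp : (g p).1.1 = p := LinearMap.congr_fun hg p
  obtain ⟨u, v, w, h1, h2, h3⟩ := (g p).2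
  rw [hgp] at h1 h2
  exact ⟨u, v, w, h1, h2, h3⟩

variable (S : I → Finset ℤ)

/-- The Fourier coefficients with index in `S i` of the components on the internal edges `i`. -/
def fourierMap : G.Hilb →ₗ[ℂ] ((i : I) → S i → ℂ) :=
  LinearMap.pi fun i => LinearMap.pi fun n =>
    (innerSL ℂ (expLp (G.a i) n)).toLinearMap ∘ₗ
      (PiLp.projₗ 2 (fun j : E ⊕ I => Lp ℂ 2 (volume.restrict (G.interval j))) (Sum.inr i))

theorem le_norm_of_forall_le {ψ φ : G.Hilb} {r : ℝ} (hr : 0 ≤ r)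
    (h : ∀ j, r * ‖ψ j‖ ≤ ‖φ j‖) : r * ‖ψ‖ ≤ ‖φ‖ := by
  refine le_of_sq_le_sq ?_ (norm_nonneg _)
  rw [mul_pow, PiLp.norm_sq_eq_of_L2, PiLp.norm_sq_eq_of_L2, Finset.mul_sum]
  refine Finset.sum_le_sum fun j _ => ?_
  rw [← mul_pow]
  exact pow_le_pow_left₀ (by positivity) (h j) 2

theorem norm_units_smul {H : Type*} [NormedAddCommGroup H] [NormedSpace ℂ H] (s : ℤˣ) (x : H) :
    ‖((s : ℤ) : ℂ) • x‖ = ‖x‖ := by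
  rcases Int.units_eq_one_or s with rfl | rfl <;> simp

/-- Vanishing boundary values on all edges, and vanishing low Fourier coefficients on the internal
edges of sign `s`, bound the distance of `T` from the center of the interval between `0` and
`2 s r`. On the edges of the other sign this holds because `s T ≤ 0` there. -/
theorem le_norm_sub_of_trace_eq_zero {s : ℤˣ} (hs : G.extEdges s = ∅) {r : ℝ} (hr : 0 ≤ r)
    (hS : ∀ i, G.sgn (Sum.inr i) = s → ∀ n, freq (G.a i) n ^ 2 < 2 * r → n ∈ S i)
    {p : G.Hilb × G.Hilb} {u v : E ⊕ I → ℝ → ℂ} {w : G.Hilb}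
    (h1 : ∀ j, IsH2Rep (G.interval j) (p.1 j) (u j) (v j) (w j))
    (h2 : ∀ j, p.2 j = -(((G.sgn j : ℤ) : ℂ) • w j)) (hu : G.trace u = 0) (hv : G.dtrace v = 0)
    (hf : G.fourierMap S p.1 = 0) :
    r * ‖p.1‖ ≤ ‖p.2 - ((((s : ℤ) : ℝ) * r : ℝ) : ℂ) • p.1‖ := by
  have hu0 : ∀ k, G.trace u k = 0 := fun k => by rw [hu]; rfl
  have hv0 : ∀ k, G.dtrace v k = 0 := fun k => by rw [hv]; rfl
  refine G.le_norm_of_forall_le hr fun j => ?_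
  rw [PiLp.sub_apply, PiLp.smul_apply, h2 j]
  by_cases hj : G.sgn j = s
  · have e : -(((G.sgn j : ℤ) : ℂ) • w j) - ((((s : ℤ) : ℝ) * r : ℝ) : ℂ) • p.1 j =
        ((((-s : ℤˣ) : ℤ)) : ℂ) • (w j + (r : ℂ) • p.1 j) := by
      rw [hj]; push_cast; module
    rw [e, norm_units_smul]
    rcases j with e' | i
    · have : e' ∈ G.extEdges s := by simp [extEdges, hj]
      rw [hs] at this
      simp at this
    · refine (h1 (Sum.inr i)).le_norm_add (G.a_pos i) ?_ ?_ fun n hn => ?_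
      · have e1 := hu0 (Sum.inr (Sum.inl i))
        have e2 := hu0 (Sum.inr (Sum.inr i))
        simp only [trace, Sum.elim_inr, Sum.elim_inl] at e1 e2
        rw [e1, e2]
      · have e1 := hv0 (Sum.inr (Sum.inl i))
        have e2 := hv0 (Sum.inr (Sum.inr i))
        simp only [dtrace, Sum.elim_inr, Sum.elim_inl, neg_eq_zero] at e1 e2
        rw [e1, e2]
      · exact congrFun (congrFun hf i) ⟨n, hS i hj n hn⟩
  · have hj' : G.sgn j = -s := Int.units_ne_iff_eq_neg.1 hj
    have e : -(((G.sgn j : ℤ) : ℂ) • w j) - ((((s : ℤ) : ℝ) * r : ℝ) : ℂ) • p.1 j =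
        (((s : ℤ)) : ℂ) • (w j - (r : ℂ) • p.1 j) := by
      rw [hj']; push_cast; module
    rw [e, norm_units_smul]
    refine le_norm_sub_of_re_inner_nonpos ?_ hr
    rcases j with e' | i
    · exact (h1 (Sum.inl e')).re_inner_nonpos_of_Ici (hu0 (Sum.inl e'))
    · exact (h1 (Sum.inr i)).re_inner_nonpos_of_Icc (G.a_pos i).le (hu0 (Sum.inr (Sum.inl i)))
        (hu0 (Sum.inr (Sum.inr i)))

/-! ### Trigonometric polynomials on the internal edges -/

theorem isH2Rep_sum {s : Set ℝ} {ι : Type*} (F : Finset ι) (c : ι → ℂ)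
    {ψ w : ι → Lp ℂ 2 (volume.restrict s)} {u v : ι → ℝ → ℂ}
    (h : ∀ k, IsH2Rep s (ψ k) (u k) (v k) (w k)) :
    IsH2Rep s (∑ k ∈ F, c k • ψ k) (∑ k ∈ F, c k • u k) (∑ k ∈ F, c k • v k)
      (∑ k ∈ F, c k • w k) := by
  classical
  induction F using Finset.induction_on with
  | empty => simpa using IsH2Rep.zero s
  | insert k F hk ih =>
    simp only [Finset.sum_insert hk]
    exact ((h k).smul (c k)).add ih

/-- The trigonometric polynomials with frequencies in `S i` on the edges `i`. -/
def trigFun : ((i : I) → S i → ℂ) →ₗ[ℂ] (E ⊕ I → ℝ → ℂ) :=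
  edgeSum S (M := fun _ => ℝ → ℂ) fun i n => expFun (G.a i) n

/-- The derivatives of the trigonometric polynomials with frequencies in `S i` on the edges `i`. -/
def trigDeriv : ((i : I) → S i → ℂ) →ₗ[ℂ] (E ⊕ I → ℝ → ℂ) :=
  edgeSum S (M := fun _ => ℝ → ℂ) fun i n =>
    (freq (G.a i) n * Complex.I : ℂ) • expFun (G.a i) n

/-- The classes in `L²` of the trigonometric polynomials. -/
def trigLp : ((i : I) → S i → ℂ) →ₗ[ℂ] G.Hilb :=
  (WithLp.linearEquiv 2 ℂ _).symm.toLinearMap ∘ₗ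
    edgeSum S (M := fun j : E ⊕ I => Lp ℂ 2 (volume.restrict (G.interval j)))
      fun i n => expLp (G.a i) n

/-- The classes in `L²` of the second derivatives of the trigonometric polynomials. -/
def trigDerivDeriv : ((i : I) → S i → ℂ) →ₗ[ℂ] G.Hilb :=
  (WithLp.linearEquiv 2 ℂ _).symm.toLinearMap ∘ₗ
    edgeSum S (M := fun j : E ⊕ I => Lp ℂ 2 (volume.restrict (G.interval j)))
      fun i n => ((-(freq (G.a i) n : ℂ) ^ 2) • expLp (G.a i) n)

/-- The classes in `L²` of `τ ψ` for the trigonometric polynomials `ψ`. -/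
def trigTau : ((i : I) → S i → ℂ) →ₗ[ℂ] G.Hilb :=
  (WithLp.linearEquiv 2 ℂ _).symm.toLinearMap ∘ₗ
    edgeSum S (M := fun j : E ⊕ I => Lp ℂ 2 (volume.restrict (G.interval j)))
      fun i n => ((((G.sgn (Sum.inr i) : ℤ) : ℂ) * (freq (G.a i) n : ℂ) ^ 2) • expLp (G.a i) n)

/-- The boundary values of the trigonometric polynomials and of their derivatives. -/
def trigTrace : ((i : I) → S i → ℂ) →ₗ[ℂ] BoundarySpace E I × BoundarySpace E I :=
  LinearMap.prod
    ({ toFun := G.trace, map_add' := G.trace_add, map_smul' := G.trace_smul } ∘ₗ G.trigFun S)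
    ({ toFun := G.dtrace, map_add' := G.dtrace_add, map_smul' := G.dtrace_smul } ∘ₗ G.trigDeriv S)

theorem trig_mem_graph {α : (i : I) → S i → ℂ} (hα : G.trigTrace S α = 0) :
    (G.trigLp S α, G.trigTau S α) ∈ (G.op A B).graph := by
  rw [op_graph]
  refine ⟨G.trigFun S α, G.trigDeriv S α, G.trigDerivDeriv S α, fun j => ?_, fun j => ?_, ?_⟩
  · rcases j with e | i
    · exact IsH2Rep.zero _
    · have h := isH2Rep_sum (Finset.univ : Finset (S i)) (α i)
        (fun n => isH2Rep_expLp (G.a i) n)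
      have e1 : G.trigLp S α (Sum.inr i) = _ := edgeSum_inr _ α i
      have e2 : G.trigDerivDeriv S α (Sum.inr i) = _ := edgeSum_inr _ α i
      have e3 : G.trigFun S α (Sum.inr i) = _ := edgeSum_inr _ α i
      have e4 : G.trigDeriv S α (Sum.inr i) = _ := edgeSum_inr _ α i
      rw [e1, e2, e3, e4]
      exact h
  · rcases j with e | i
    · change (0 : Lp ℂ 2 (volume.restrict (G.interval (Sum.inl e)))) = -(_ • 0)
      rw [smul_zero, neg_zero]
    · have e1 : G.trigTau S α (Sum.inr i) = _ := edgeSum_inr _ α i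
      have e2 : G.trigDerivDeriv S α (Sum.inr i) = _ := edgeSum_inr _ α i
      have key : ∀ (c σ κ : ℂ) (x : Lp ℂ 2 (volume.restrict (Icc 0 (G.a i)))),
          c • (σ * κ ^ 2) • x = -(σ • c • (-κ ^ 2) • x) := fun c σ κ x => by module
      rw [e1, e2, Finset.smul_sum, ← Finset.sum_neg_distrib]
      exact Finset.sum_congr rfl fun n _ => key _ _ _ _
  · have h1 : G.trace (G.trigFun S α) = 0 := congrArg Prod.fst hα
    have h2 : G.dtrace (G.trigDeriv S α) = 0 := congrArg Prod.snd hα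
    rw [h1, h2, map_zero, map_zero, add_zero]

theorem norm_sq_sum_smul_expLp {a : ℝ} (ha : 0 < a) (F : Finset ℤ) (c : F → ℂ) :
    ‖∑ n : F, c n • expLp a n‖ ^ 2 = ∑ n : F, ‖c n‖ ^ 2 := by
  have h := ((orthonormal_expLp ha).comp (Subtype.val : F → ℤ) Subtype.val_injective).inner_sum
    c c Finset.univ
  simp only [Function.comp_apply] at h
  rw [inner_self_eq_norm_sq_to_K] at h
  apply Complex.ofReal_injective
  push_cast
  refine h.trans (Finset.sum_congr rfl fun n _ => ?_)
  rw [mul_comm, Complex.mul_conj, Complex.normSq_eq_norm_sq]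
  push_cast
  rfl

/-- On trigonometric polynomials with frequencies `0 < κ² < 2 r` on the edges of sign `s`, the
operator `τ` acts as `s κ²`, at distance less than `r` from `s r`. -/
theorem norm_trigTau_sub_lt {s : ℤˣ} {r : ℝ} (hr : 0 < r)
    (hS : ∀ i, ∀ n ∈ S i, G.sgn (Sum.inr i) = s ∧ 0 < freq (G.a i) n ^ 2 ∧
      freq (G.a i) n ^ 2 < 2 * r)
    {α : (i : I) → S i → ℂ} (hα : α ≠ 0) :
    ‖G.trigTau S α - ((((s : ℤ) : ℝ) * r : ℝ) : ℂ) • G.trigLp S α‖ < r * ‖G.trigLp S α‖ := by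
  obtain ⟨i₀, hi₀⟩ := Function.ne_iff.1 hα
  obtain ⟨n₀, hn₀⟩ := Function.ne_iff.1 hi₀
  have hcoef : ∀ i (n : S i), ‖α i n * (((G.sgn (Sum.inr i) : ℤ) : ℂ) * (freq (G.a i) n : ℂ) ^ 2 -
      ((((s : ℤ) : ℝ) * r : ℝ) : ℂ))‖ ^ 2 = (freq (G.a i) n ^ 2 - r) ^ 2 * ‖α i n‖ ^ 2 := by
    intro i n
    rw [(hS i n n.2).1, norm_mul, mul_pow, mul_comm]
    congr 1
    have : ((s : ℤ) : ℂ) * (freq (G.a i) n : ℂ) ^ 2 - ((((s : ℤ) : ℝ) * r : ℝ) : ℂ) =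
        ((s : ℤ) : ℂ) • ((freq (G.a i) n ^ 2 - r : ℝ) : ℂ) := by
      rw [smul_eq_mul]; push_cast; ring
    rw [this, norm_units_smul, Complex.norm_real, Real.norm_eq_abs, sq_abs]
  have hlt : ∀ i (n : S i), (freq (G.a i) n ^ 2 - r) ^ 2 < r ^ 2 := fun i n => by
    obtain ⟨-, h1, h2⟩ := hS i n n.2
    exact sq_lt_sq' (by linarith) (by linarith)
  have hψ : ∀ i, ‖G.trigLp S α (Sum.inr i)‖ ^ 2 = ∑ n : S i, ‖α i n‖ ^ 2 := by
    intro i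
    have e1 : G.trigLp S α (Sum.inr i) = _ := edgeSum_inr _ α i
    rw [e1]
    exact norm_sq_sum_smul_expLp (G.a_pos i) (S i) (α i)
  have hφ : ∀ i, ‖(G.trigTau S α - ((((s : ℤ) : ℝ) * r : ℝ) : ℂ) • G.trigLp S α) (Sum.inr i)‖ ^ 2 =
      ∑ n : S i, (freq (G.a i) n ^ 2 - r) ^ 2 * ‖α i n‖ ^ 2 := by
    intro i
    have e1 : G.trigTau S α (Sum.inr i) = _ := edgeSum_inr _ α i
    have e2 : G.trigLp S α (Sum.inr i) = _ := edgeSum_inr _ α i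
    rw [PiLp.sub_apply, PiLp.smul_apply, e1, e2, Finset.smul_sum, ← Finset.sum_sub_distrib]
    simp only [← hcoef]
    rw [← norm_sq_sum_smul_expLp (G.a_pos i)]
    congr 2
    have key : ∀ (c σ κ : ℂ) (x : Lp ℂ 2 (volume.restrict (Icc 0 (G.a i)))),
        c • σ • x - κ • c • x = (c * (σ - κ)) • x := fun c σ κ x => by module
    exact Finset.sum_congr rfl fun n _ => key _ _ _ _
  refine lt_of_pow_lt_pow_left₀ 2 (by positivity) ?_
  rw [mul_pow, PiLp.norm_sq_eq_of_L2, PiLp.norm_sq_eq_of_L2, Finset.mul_sum,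
    Fintype.sum_sum_type, Fintype.sum_sum_type]
  simp only [hψ, hφ]
  have hinl : ∀ e, (G.trigTau S α - ((((s : ℤ) : ℝ) * r : ℝ) : ℂ) • G.trigLp S α) (Sum.inl e) = 0 := by
    intro e
    rw [PiLp.sub_apply, PiLp.smul_apply]
    change (0 : Lp ℂ 2 (volume.restrict (G.interval (Sum.inl e)))) - _ • 0 = 0
    rw [smul_zero, sub_zero]
  simp only [hinl, norm_zero, ne_eq, OfNat.ofNat_ne_zero, not_false_eq_true, zero_pow,
    Finset.sum_const_zero, zero_add]
  refine lt_of_lt_of_le ?_ (le_add_of_nonneg_left (Finset.sum_nonneg fun _ _ => by positivity))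
  simp only [Finset.mul_sum]
  refine Finset.sum_lt_sum (fun i _ => Finset.sum_le_sum fun n _ => ?_) ⟨i₀, Finset.mem_univ _, ?_⟩
  · exact mul_le_mul_of_nonneg_right (hlt i n).le (by positivity)
  · refine Finset.sum_lt_sum (fun n _ => ?_) ⟨n₀, Finset.mem_univ _, ?_⟩
    · exact mul_le_mul_of_nonneg_right (hlt i₀ n).le (by positivity)
    · have : 0 < ‖α i₀ n₀‖ := norm_pos_iff.2 hn₀
      exact mul_lt_mul_of_pos_right (hlt i₀ n₀) (by positivity)

/-! ### Two-sided bounds and the asymptotics of the counting function -/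

/-- Up to the number of boundary conditions, the counting function lies between the number of
frequencies in `S` (all with `0 < κ² < lam`) and the number of those in `S'` (containing all with
`κ² < lam`). -/
theorem countEigenvalues_bounds {A B : BoundarySpace E I →ₗ[ℂ] BoundarySpace E I}
    (hT : IsSelfAdjoint (G.op A B)) {s : ℤˣ} (hs : G.extEdges s = ∅) {lam : ℝ} (hlam : 0 < lam)
    (S S' : I → Finset ℤ)
    (hS : ∀ i, ∀ n ∈ S i, G.sgn (Sum.inr i) = s ∧ 0 < freq (G.a i) n ^ 2 ∧
      freq (G.a i) n ^ 2 < lam)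
    (hS' : ∀ i, G.sgn (Sum.inr i) = s → ∀ n, freq (G.a i) n ^ 2 < lam → n ∈ S' i) :
    ((∑ i, (S i).card : ℕ) : ENNReal) ≤ (G.op A B).countEigenvalues s lam +
        (Module.finrank ℂ (BoundarySpace E I × BoundarySpace E I) : ℕ) ∧
      (G.op A B).countEigenvalues s lam ≤
        (Module.finrank ℂ (BoundarySpace E I × BoundarySpace E I) + ∑ i, (S' i).card : ℕ) := by
  have hr : 0 < lam / 2 := by positivity
  have h2r : 2 * (lam / 2) = lam := by ring
  obtain ⟨Tr, hTr⟩ := G.exists_traceMap A B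
  set Φ : (G.op A B).graph →ₗ[ℂ]
      (BoundarySpace E I × BoundarySpace E I) × ((i : I) → S' i → ℂ) :=
    LinearMap.prod Tr (G.fourierMap S' ∘ₗ LinearMap.fst ℂ _ _ ∘ₗ (G.op A B).graph.subtype) with hΦ
  set U : LinearMap.ker (G.trigTrace S) →ₗ[ℂ] (G.op A B).graph :=
    LinearMap.codRestrict _ ((LinearMap.prod (G.trigLp S) (G.trigTau S)) ∘ₗ
      (LinearMap.ker (G.trigTrace S)).subtype)
      (fun α => G.trig_mem_graph A B S α.2) with hU
  have hbounds := hT.countEigenvalues_bounds s hlam Φ (fun p hp => by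
      obtain ⟨u, v, w, h1, h2, h3⟩ := hTr p
      have hTr0 : Tr p = 0 := congrArg Prod.fst hp
      rw [hTr0] at h3
      exact G.le_norm_sub_of_trace_eq_zero S' hs hr.le (by rwa [h2r]) h1 h2
        (congrArg Prod.fst h3) (congrArg Prod.snd h3) (congrArg Prod.snd hp)) U
    (fun α hα => G.norm_trigTau_sub_lt S hr (by rwa [h2r]) (fun h => hα (Subtype.ext h)))
  have hX : ∀ F : I → Finset ℤ, Module.finrank ℂ ((i : I) → F i → ℂ) = ∑ i, (F i).card := by
    intro F
    rw [Module.finrank_pi_fintype]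
    simp
  constructor
  · have h1 := LinearMap.finrank_range_add_finrank_ker (G.trigTrace S)
    have h2 := (LinearMap.range (G.trigTrace S)).finrank_le
    rw [hX] at h1
    have h3 : ∑ i, (S i).card ≤ Module.finrank ℂ (LinearMap.ker (G.trigTrace S)) +
        Module.finrank ℂ (BoundarySpace E I × BoundarySpace E I) := by omega
    refine le_trans (Nat.cast_le.2 h3) ?_
    rw [Nat.cast_add]
    gcongr
    exact hbounds.1
  · refine hbounds.2.trans (Nat.cast_le.2 ?_)
    rw [Module.finrank_prod (R := ℂ), hX]

theorem sq_freq_lt_iff {a : ℝ} (ha : 0 < a) (n : ℤ) (lam : ℝ) :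
    freq a n ^ 2 < lam ↔ |(n : ℝ)| < a * Real.sqrt lam / (2 * Real.pi) := by
  have hpi := Real.pi_pos
  rw [lt_div_iff₀ (by positivity), ← Real.sqrt_lt_sqrt_iff (sq_nonneg _), Real.sqrt_sq_eq_abs, freq,
    abs_div, abs_mul, abs_of_pos ha, abs_of_pos (by positivity : 0 < 2 * Real.pi),
    div_lt_iff₀ ha, mul_comm (2 * Real.pi), mul_comm (Real.sqrt lam)]

/-- The number of eigenvalues is, up to a bounded error, the one for periodic boundary conditions on
the internal edges of sign `s`. -/
theorem exists_abs_countEigenvalues_sub_le {A B : BoundarySpace E I →ₗ[ℂ] BoundarySpace E I}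
    (hT : IsSelfAdjoint (G.op A B)) {s : ℤˣ} (hs : G.extEdges s = ∅) :
    ∃ D : ℝ, ∀ lam : ℝ, 0 < lam → (G.op A B).countEigenvalues s lam ≠ ⊤ ∧
      |((G.op A B).countEigenvalues s lam).toReal -
        (1 / Real.pi * ∑ i ∈ G.intEdges s, G.a i) * Real.sqrt lam| ≤ D := by
  have hpi := Real.pi_pos
  set d := Module.finrank ℂ (BoundarySpace E I × BoundarySpace E I) with hd
  refine ⟨d + ∑ _i ∈ G.intEdges s, 4, fun lam hlam => ?_⟩
  set x : I → ℝ := fun i => G.a i * Real.sqrt lam / (2 * Real.pi) with hx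
  have hx0 : ∀ i, 0 ≤ x i := fun i => by have := G.a_pos i; positivity
  -- the frequencies with `κ² < lam` are those with index `|n| < x i`
  set m : I → ℤ := fun i => ⌊x i⌋ with hm
  have hm0 : ∀ i, 0 ≤ m i := fun i => Int.floor_nonneg.2 (hx0 i)
  have hmx : ∀ i, (m i : ℝ) ≤ x i := fun i => Int.floor_le _
  have hxm : ∀ i, x i < m i + 1 := fun i => Int.lt_floor_add_one _
  have hfin : ∀ i, ∀ n : ℤ, freq (G.a i) n ^ 2 < lam ↔ |(n : ℝ)| < x i := fun i n =>
    sq_freq_lt_iff (G.a_pos i) n lam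
  obtain ⟨hlow, hup⟩ := G.countEigenvalues_bounds hT hs hlam
    (fun i => if G.sgn (Sum.inr i) = s then (Finset.Icc (-(m i - 1)) (m i - 1)).erase 0 else ∅)
    (fun i => if G.sgn (Sum.inr i) = s then Finset.Icc (-m i) (m i) else ∅)
    (by
      intro i n hn
      split_ifs at hn with hi
      · rw [Finset.mem_erase, Finset.mem_Icc] at hn
        refine ⟨hi, ?_, ?_⟩
        · have h1 : (n : ℝ) ≠ 0 := by exact_mod_cast hn.1
          have h2 := G.a_pos i
          have : freq (G.a i) n ≠ 0 := by rw [freq]; positivity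
          positivity
        · rw [hfin]
          have h1 : |n| ≤ m i - 1 := abs_le.2 hn.2
          have h2 : |(n : ℝ)| ≤ m i - 1 := by exact_mod_cast h1
          linarith [hmx i]
      · simp at hn)
    (by
      intro i hi n hn
      rw [hfin] at hn
      rw [if_pos hi, Finset.mem_Icc, ← abs_le]
      have h1 : |(n : ℝ)| < m i + 1 := hn.trans (hxm i)
      have h2 : |n| < m i + 1 := by exact_mod_cast h1
      omega)
  set N := (G.op A B).countEigenvalues s lam with hN
  have hNtop : N ≠ ⊤ := ne_top_of_le_ne_top (ENNReal.natCast_ne_top _) hup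
  refine ⟨hNtop, ?_⟩
  have hmain : (1 / Real.pi * ∑ i ∈ G.intEdges s, G.a i) * Real.sqrt lam =
      ∑ i ∈ G.intEdges s, 2 * x i := by
    rw [Finset.mul_sum, Finset.sum_mul]
    refine Finset.sum_congr rfl fun i _ => ?_
    simp only [hx]
    field_simp
  have hup' := ENNReal.toReal_mono (ENNReal.natCast_ne_top _) hup
  have hlow' := ENNReal.toReal_mono
    (ENNReal.add_ne_top.2 ⟨hNtop, ENNReal.natCast_ne_top _⟩) hlow
  rw [ENNReal.toReal_add hNtop (ENNReal.natCast_ne_top _)] at hlow'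
  simp only [ENNReal.toReal_natCast, apply_ite Finset.card, Finset.card_empty, ← Finset.sum_filter]
    at hup' hlow'
  push_cast at hup' hlow'
  change _ ≤ (d : ℝ) + ∑ i ∈ G.intEdges s, _ at hup'
  change ∑ i ∈ G.intEdges s, _ ≤ _ at hlow'
  have hA : ∑ i ∈ G.intEdges s, ((Finset.Icc (-m i) (m i)).card : ℝ) ≤
      ∑ i ∈ G.intEdges s, 2 * x i + ∑ _i ∈ G.intEdges s, (4 : ℝ) := by
    rw [← Finset.sum_add_distrib]
    refine Finset.sum_le_sum fun i _ => ?_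
    have h1 : ((Finset.Icc (-m i) (m i)).card : ℤ) = 2 * m i + 1 := by
      rw [Int.card_Icc]; have := hm0 i; omega
    have h2 : ((Finset.Icc (-m i) (m i)).card : ℝ) = 2 * m i + 1 := by exact_mod_cast h1
    rw [h2]
    linarith [hmx i]
  have hB : ∑ i ∈ G.intEdges s, 2 * x i - ∑ _i ∈ G.intEdges s, (4 : ℝ) ≤
      ∑ i ∈ G.intEdges s, (((Finset.Icc (-(m i - 1)) (m i - 1)).erase 0).card : ℝ) := by
    rw [← Finset.sum_sub_distrib]
    refine Finset.sum_le_sum fun i _ => ?_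
    have h1 : 2 * m i - 2 ≤ (((Finset.Icc (-(m i - 1)) (m i - 1)).erase 0).card : ℤ) := by
      have h2 := Finset.pred_card_le_card_erase (s := Finset.Icc (-(m i - 1)) (m i - 1)) (a := 0)
      have h3 : (Finset.Icc (-(m i - 1)) (m i - 1)).card = (2 * m i - 1).toNat := by
        rw [Int.card_Icc]; congr 1; ring
      omega
    have h2 : 2 * (m i : ℝ) - 2 ≤ (((Finset.Icc (-(m i - 1)) (m i - 1)).erase 0).card : ℝ) := by
      exact_mod_cast h1
    linarith [hxm i]
  rw [hmain, abs_le]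
  constructor <;> linarith

theorem weylLaw {A B : BoundarySpace E I →ₗ[ℂ] BoundarySpace E I}
    (hT : IsSelfAdjoint (G.op A B)) {s : ℤˣ} (hs : G.extEdges s = ∅) : G.WeylLaw A B s := by
  obtain ⟨D, hD⟩ := G.exists_abs_countEigenvalues_sub_le hT hs
  refine ⟨fun lam => ?_, ?_⟩
  · rcases lt_or_ge 0 lam with h | h
    · exact (hD lam h).1
    · have : IsEmpty (Ioo (0 : ℝ) lam) := by rw [Ioo_eq_empty (by linarith)]; infer_instance
      rw [LinearPMap.countEigenvalues, tsum_empty]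
      exact ENNReal.zero_ne_top
  · have hlim : Tendsto (fun lam : ℝ => D / Real.sqrt lam) atTop (𝓝 0) :=
      Real.tendsto_sqrt_atTop.const_div_atTop D
    rw [tendsto_iff_dist_tendsto_zero]
    refine squeeze_zero' (Eventually.of_forall fun _ => dist_nonneg) ?_ hlim
    filter_upwards [eventually_gt_atTop 0] with lam hlam
    have hsq : 0 < Real.sqrt lam := Real.sqrt_pos.2 hlam
    rw [← Real.sqrt_eq_rpow, Real.dist_eq, le_div_iff₀ hsq, ← abs_of_pos hsq, ← abs_mul,
      abs_of_pos hsq, sub_mul, div_mul_cancel₀ _ hsq.ne']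
    exact (hD lam hlam).2

end SignedMetricGraph

end

theorem proposition6p6 {V E I : Type*} [Fintype V] [Fintype E] [Fintype I]
    (G : SignedMetricGraph V E I) (A B : BoundarySpace E I →ₗ[ℂ] BoundarySpace E I)
    (hT : IsSelfAdjoint (G.op A B)) :
    (IsEmpty E → G.WeylLaw A B 1 ∧ G.WeylLaw A B (-1)) ∧
    (Nonempty E →
      (G.extEdges (-1) = ∅ → G.WeylLaw A B (-1)) ∧
      (G.extEdges 1 = ∅ → G.WeylLaw A B 1)) := by
  refine ⟨fun hE => ⟨?_, ?_⟩, fun _ => ⟨fun h => G.weylLaw hT h, fun h => G.weylLaw hT h⟩⟩ <;>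
    exact G.weylLaw hT (Finset.eq_empty_of_isEmpty _)
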